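/- **Setting.** Let $\Gamma=(G,\sigma)$ be a connected signed graph: $G$ is a finite simple connected graph with vertices $1,\dots,n$, $n\ge 2$, and edges $e_1,\dots,e_m$, and $\sigma$ assigns a sign $\pm1$ to each edge. A cycle is balanced if it has an even number of negative edges; $\Gamma$ is balanced if all its cycles are. The Laplacian is $L=D-A$, with $D$ the diagonal matrix of vertex degrees and $A_{ij}=\sigma(ij)$ if $ij$ is an edge, $A_{ij}=0$ otherwise. Let $N$ be any incidence matrix of $\Gamma$, i.e. an $n\times m$ matrix with $N_{ik}=0$ if $i\notin e_k$, $N_{ik}=\pm1$ if $i\in e_k$, and $N_{ik}N_{jk}=-\sigma(e_k)$ for $e_k=\{i,j\}$. $X^\dagger$ denotes the Moore–Penrose inverse of a real matrix $X$. A positive edge $e_k=\{u,v\}$ with $N_{uk}=1$, $N_{vk}=-1$ has tail $u$ and head $v$; a negative edge has as tail its smaller and as head its larger end. Put $w(e_k)=-1$ if $e_k$ is negative and both nonzero entries of column $k$ of $N$ are $-1$, and $w(e_k)=1$ otherwise. The sign of a path is the product of the signs of its edges ($1$ for a path without edges). For a subgraph $F$ containing $e$, $F_h(e)$ and $F_t(e)$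 are the vertex sets of the components of $F\setminus e$ that contain the head and the tail of $e$, and $P_{F}(e-j)$ is the shortest path in $F$ between the edge $e$ and the vertex $j$ that does not contain $e$. **Theorem.** $L=NN^{\mathsf T}$ and $L^\dagger=(N^\dagger)^{\mathsf T}N^\dagger$. Moreover: (a) Suppose $\Gamma$ is balanced. Let $\mathcal S(\Gamma)$ be the set of spanning trees of $\Gamma$ and $\tau(\Gamma)=|\mathcal S(\Gamma)|$. Then for all vertices $i,j$ $$(L^\dagger)_{ij}=\frac1{n^2\tau(\Gamma)^2}\sum_{k=1}^m\ \sum_{\substack{(T,T')\in\mathcal S(\Gamma)^2\\ e_k\in T,\ e_k\in T'}}\operatorname{sgn}(P_{T}(e_k-i))\,\operatorname{sgn}(P_{T'}(e_k-j))\,\Psi_{T,T'}(e_k,i,j),$$ $$\Psi_{T,T'}(e,i,j)=\begin{cases}|T_h(e)|\,|T'_h(e)| & i\in T_t(e),\ j\in T'_t(e),\\ |T_t(e)|\,|T'_t(e)| & i\in T_h(e),\ j\in T'_h(e),\\ -\sigma(e)\,|T_h(e)|\,|T'_t(e)| & i\in T_t(e),\ j\in T'_h(e),\\ -\sigma(e)\,|T_t(e)|\,|T'_h(e)|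 & i\in T_h(e),\ j\in T'_t(e).\end{cases}$$ (b) Suppose $\Gamma$ is unbalanced. Let $\mathcal{TU}_n(\Gamma)$ be the set of spanning subgraphs $H$ of $\Gamma$ with $n$ edges each of whose components is a tree or an unbalanced unicyclic graph (a connected graph with exactly one cycle, that cycle being unbalanced), and let $c(H)$ be the number of unbalanced unicyclic components of $H$. Let $N_H$ be the $n\times m$ matrix obtained from $N$ by replacing the columns of the edges outside $H$ by zero. Then $L$ is invertible and for all vertices $i,j$ $$(L^{-1})_{ij}=\frac1{\bigl(\sum_{H\in\mathcal{TU}_n(\Gamma)}4^{c(H)}\bigr)^2}\sum_{k=1}^m\Bigl(\sum_{\substack{H\in\mathcal{TU}_n(\Gamma)\\ e_k\in H}}4^{c(H)}(N_H^\dagger)_{ki}\Bigr)\Bigl(\sum_{\substack{H\in\mathcal{TU}_n(\Gamma)\\ e_k\in H}}4^{c(H)}(N_H^\dagger)_{kj}\Bigr).$$ Here, for $H\in\mathcal{TU}_n(\Gamma)$, an edge $e_k\in H$ and a vertex $j$, with $U$ the component of $H$ containing $e_k$ and $C$ the cycle of $U$, $$(N_H^\dagger)_{kj}=w(e_k)\cdot\begin{cases}0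 & j\notin U,\\ \tfrac12\operatorname{sgn}(P) & j\in U,\ e_k\in C,\\ 0 & j\in U,\ e_k\notin C,\ j\text{ lies in the component of }U\setminus e_k\text{ containing }C,\\ -\operatorname{sgn}(P_H(e_k-j)) & \text{otherwise, if }e_k\text{ is positive and }j\in U_h(e_k),\\ \operatorname{sgn}(P_H(e_k-j)) & \text{otherwise,}\end{cases}$$ where $P$ is the path from the tail of $e_k$ to $j$ in the tree $U\setminus e_k$. -/

import Mathlib

/-! ### Moore–Penrose inverse of a real matrix -/

section MoorePenrose

open Matrix

variable {m n : Type*} [Fintype m] [Fintype n]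

/-- `X` satisfies the four Penrose equations for the real matrix `A`. -/
def IsMoorePenroseInverse (A : Matrix m n ℝ) (X : Matrix n m ℝ) : Prop :=
  A * X * A = A ∧ X * A * X = X ∧ (A * X)ᵀ = A * X ∧ (X * A)ᵀ = X * A

theorem exists_normal_equation (A : Matrix m n ℝ) : ∃ G : Matrix n m ℝ, Aᵀ * A * G = Aᵀ := by
  classical
  have hr : LinearMap.range (Aᵀ * A).mulVecLin = LinearMap.range Aᵀ.mulVecLin := by
    apply Submodule.eq_of_le_of_finrank_eq
    · rw [Matrix.mulVecLin_mul]
      exact LinearMap.range_comp_le_range _ _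
    · have h1 : (Aᵀ * A).rank = Aᵀ.rank := by
        rw [Matrix.rank_transpose_mul_self, Matrix.rank_transpose]
      exact h1
  have hc : ∀ j : m, ∃ g : n → ℝ, (Aᵀ * A) *ᵥ g = Aᵀ *ᵥ (Pi.single j 1) := by
    intro j
    have : Aᵀ *ᵥ (Pi.single j 1) ∈ LinearMap.range (Aᵀ * A).mulVecLin := by
      rw [hr]
      exact ⟨Pi.single j 1, rfl⟩
    obtain ⟨g, hg⟩ := this
    exact ⟨g, hg⟩
  choose g hg using hc
  refine ⟨Matrix.of fun i j => g j i, ?_⟩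
  ext i j
  have h := congrFun (hg j) i
  rw [Matrix.mulVec_single_one] at h
  exact h

theorem exists_isMoorePenroseInverse (A : Matrix m n ℝ) :
    ∃ X : Matrix n m ℝ, IsMoorePenroseInverse A X := by
  obtain ⟨G, hG⟩ := exists_normal_equation A
  obtain ⟨K, hK⟩ := exists_normal_equation Aᵀ
  rw [transpose_transpose] at hK
  have hGs : (A * G)ᵀ = A * G := by
    have : Gᵀ * (Aᵀ * A * G) = Gᵀ * Aᵀ := by rw [hG]
    have h2 : (A * G)ᵀ * (A * G) = (A * G)ᵀ := by
      rw [transpose_mul]; simpa [Matrix.mul_assoc] using this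
    have h3 := congrArg Matrix.transpose h2
    rw [transpose_mul, transpose_transpose] at h3
    exact h2.symm.trans h3
  have hGA : A * G * A = A := by
    have := congrArg Matrix.transpose hG
    rw [transpose_mul, transpose_mul, transpose_transpose] at this
    rw [← hGs, transpose_mul, Matrix.mul_assoc]; exact this
  have hKs : (Kᵀ * A)ᵀ = Kᵀ * A := by
    have h2 : Kᵀ * A * (Kᵀ * A)ᵀ = Kᵀ * A := by
      have : Kᵀ * (A * Aᵀ * K) = Kᵀ * A := by rw [hK]
      rw [transpose_mul, transpose_transpose]; simpa [Matrix.mul_assoc] using this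
    have h3 := congrArg Matrix.transpose h2
    rw [transpose_mul, transpose_transpose] at h3
    exact h3.symm.trans h2
  have hKA : A * (Kᵀ * A) = A := by
    rw [← hKs, transpose_mul, transpose_transpose, ← Matrix.mul_assoc]; exact hK
  have e1 : A * (Kᵀ * A * G) = A * G := by rw [← Matrix.mul_assoc, hKA]
  have e2 : Kᵀ * A * G * A = Kᵀ * A := by
    rw [Matrix.mul_assoc Kᵀ A G, Matrix.mul_assoc Kᵀ (A * G) A, hGA]
  refine ⟨Kᵀ * A * G, ?_, ?_, ?_, ?_⟩
  · rw [e1, hGA]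
  · rw [e2, Matrix.mul_assoc Kᵀ A (Kᵀ * A * G), e1, ← Matrix.mul_assoc]
  · rw [e1, hGs]
  · rw [e2, hKs]

theorem IsMoorePenroseInverse.unique {A : Matrix m n ℝ} {X Y : Matrix n m ℝ}
    (hX : IsMoorePenroseInverse A X) (hY : IsMoorePenroseInverse A Y) : X = Y := by
  obtain ⟨x1, x2, x3, x4⟩ := hX
  obtain ⟨y1, y2, y3, y4⟩ := hY
  have hA : A * X = A * Y := by
    have : (A * Y * (A * X))ᵀ = A * X * (A * Y) := by rw [transpose_mul, x3, y3]
    rw [← Matrix.mul_assoc, y1, ← Matrix.mul_assoc, x1, x3] at this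
    exact this
  have hB : X * A = Y * A := by
    have : (X * A * (Y * A))ᵀ = Y * A * (X * A) := by rw [transpose_mul, x4, y4]
    rw [Matrix.mul_assoc X A, ← Matrix.mul_assoc A Y A, y1, Matrix.mul_assoc Y A,
      ← Matrix.mul_assoc A X A, x1, x4] at this
    exact this
  calc X = X * A * X := x2.symm
    _ = Y * A * Y := by rw [hB, Matrix.mul_assoc, hA, ← Matrix.mul_assoc]
    _ = Y := y2

/-- The Moore–Penrose inverse `A†` of a real matrix `A`. -/
noncomputable def moorePenrose (A : Matrix m n ℝ) : Matrix n m ℝ :=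
  (exists_isMoorePenroseInverse A).choose

theorem moorePenrose_spec (A : Matrix m n ℝ) : IsMoorePenroseInverse A (moorePenrose A) :=
  (exists_isMoorePenroseInverse A).choose_spec

end MoorePenrose

/-! ### Signed graphs -/

/-- A (simple) signed graph on the vertex set `V`: an underlying graph with a sign on each edge. -/
structure SignedGraph (V : Type*) where
  graph : SimpleGraph V
  sign : graph.edgeSet → ℤˣ

namespace SignedGraph

open SimpleGraph

variable {V : Type*}

/-- The sign function, extended by `1` to the unordered pairs that are not edges. -/
noncomputable def edgeSign (Γ : SignedGraph V) (e : Sym2 V) : ℤˣ :=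
  open Classical in if h : e ∈ Γ.graph.edgeSet then Γ.sign ⟨e, h⟩ else 1

/-- The set of cycles of a graph, a cycle being given by the set of its edges. -/
def cycles (F : SimpleGraph V) : Set (Set (Sym2 V)) :=
  {C | ∃ (v : V) (p : F.Walk v v), p.IsCycle ∧ C = {e | e ∈ p.edges}}

/-- The cycles of `F` that lie in the connected component `c`. -/
def cyclesIn (F : SimpleGraph V) (c : F.ConnectedComponent) : Set (Set (Sym2 V)) :=
  {C | ∃ (v : V) (p : F.Walk v v), v ∈ c.supp ∧ p.IsCycle ∧ C = {e | e ∈ p.edges}}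

/-- A cycle is balanced if it has an even number of negative edges. -/
def IsBalancedCycle (Γ : SignedGraph V) (C : Set (Sym2 V)) : Prop :=
  Even {e ∈ C | Γ.edgeSign e = -1}.ncard

/-- A signed graph is balanced if all its cycles are balanced. -/
def Balanced (Γ : SignedGraph V) : Prop :=
  ∀ C ∈ cycles Γ.graph, Γ.IsBalancedCycle C

/-- The sign of a walk, the product of the signs of its edges. -/
noncomputable def walkSign (Γ : SignedGraph V) {F : SimpleGraph V} {u v : V} (p : F.Walk u v) :
    ℤˣ :=
  (p.edges.map Γ.edgeSign).prod

/-- The sign of a shortest path in `F` from a vertex of `A` to `j` (and `0` if there is no path).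
It is only used where the path is unique. -/
noncomputable def pathSign (Γ : SignedGraph V) (F : SimpleGraph V) (A : Set V) (j : V) : ℝ :=
  open Classical in
  if h : ∃ (u : V) (p : F.Walk u j), u ∈ A ∧
      ∀ (u' : V) (q : F.Walk u' j), u' ∈ A → p.length ≤ q.length then
    ((Γ.walkSign h.choose_spec.choose : ℤ) : ℝ)
  else 0

/-- `F ∖ e`, the graph `F` with the edge `e` deleted (and all vertices kept). -/
def del (F : SimpleGraph V) (e : Sym2 V) : SimpleGraph V := F.deleteEdges {e}

/-- `sgn(P_{e-j})`: the sign of a shortest path in `F` between the edge `e` and the vertex `j`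
that does not contain `e`. -/
noncomputable def edgePathSign (Γ : SignedGraph V) (F : SimpleGraph V) (e : Sym2 V) (j : V) : ℝ :=
  Γ.pathSign (del F e) {u | u ∈ e} j

/-! #### Incidence matrices, adjacency matrix, Laplacian matrix -/

/-- `N` is an incidence matrix of `Γ` (with columns indexed by the edges). -/
def IsIncidenceMatrix (Γ : SignedGraph V) (N : Matrix V Γ.graph.edgeSet ℝ) : Prop :=
  ∀ e : Γ.graph.edgeSet,
    (∀ i, i ∉ (e : Sym2 V) → N i e = 0) ∧
    (∀ i, i ∈ (e : Sym2 V) → N i e = 1 ∨ N i e = -1) ∧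
    (∀ i j, i ∈ (e : Sym2 V) → j ∈ (e : Sym2 V) → i ≠ j →
      N i e * N j e = -((Γ.sign e : ℤ) : ℝ))

/-- The signed adjacency matrix. -/
noncomputable def adjMatrix (Γ : SignedGraph V) : Matrix V V ℝ :=
  open Classical in
  fun i j => if Γ.graph.Adj i j then ((Γ.edgeSign s(i, j) : ℤ) : ℝ) else 0

/-- The Laplacian matrix, degree matrix minus signed adjacency matrix. -/
noncomputable def laplacian [Fintype V] [DecidableEq V] (Γ : SignedGraph V)
    [DecidableRel Γ.graph.Adj] : Matrix V V ℝ :=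
  Γ.graph.degMatrix ℝ - Γ.adjMatrix

/-- For a subgraph `H`, the matrix `N_H`: the columns of `N` belonging to edges outside `H`
are replaced by zero. -/
noncomputable def restrictCols (Γ : SignedGraph V) (N : Matrix V Γ.graph.edgeSet ℝ)
    (H : SimpleGraph V) : Matrix V Γ.graph.edgeSet ℝ :=
  open Classical in fun i e => if (e : Sym2 V) ∈ H.edgeSet then N i e else 0

section Ordered

variable [LinearOrder V]

/-- The head of an edge. A negative edge has its larger end as head. A positive edge is directed
from its end with entry `1` in `N` to its end with entry `-1` in `N`. -/
noncomputable def head (Γ : SignedGraph V) (N : Matrix V Γ.graph.edgeSet ℝ)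
    (e : Γ.graph.edgeSet) : V :=
  open Classical in
  if Γ.sign e = 1 ∧ N (e : Sym2 V).inf e = -1 then (e : Sym2 V).inf else (e : Sym2 V).sup

/-- The tail of an edge, its end that is not the head. -/
noncomputable def tail (Γ : SignedGraph V) (N : Matrix V Γ.graph.edgeSet ℝ)
    (e : Γ.graph.edgeSet) : V :=
  open Classical in
  if Γ.sign e = 1 ∧ N (e : Sym2 V).inf e = -1 then (e : Sym2 V).sup else (e : Sym2 V).inf

/-- `F_h(e)`, the vertices of the component of `F ∖ e` that contains the head of `e`. -/
def headComp (Γ : SignedGraph V) (N : Matrix V Γ.graph.edgeSet ℝ) (F : SimpleGraph V)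
    (e : Γ.graph.edgeSet) : Set V :=
  {j | (del F e).Reachable (Γ.head N e) j}

/-- `F_t(e)`, the vertices of the component of `F ∖ e` that contains the tail of `e`. -/
def tailComp (Γ : SignedGraph V) (N : Matrix V Γ.graph.edgeSet ℝ) (F : SimpleGraph V)
    (e : Γ.graph.edgeSet) : Set V :=
  {j | (del F e).Reachable (Γ.tail N e) j}

end Ordered

/-- `w(e)`: it is `-1` if `e` is a negative edge with both ends negative, and `1` otherwise. -/
noncomputable def endWeight (Γ : SignedGraph V) (N : Matrix V Γ.graph.edgeSet ℝ)
    (e : Γ.graph.edgeSet) : ℝ :=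
  open Classical in if Γ.sign e = -1 ∧ ∀ i ∈ (e : Sym2 V), N i e = -1 then -1 else 1

/-! #### The balanced case -/

/-- The set of spanning trees. -/
noncomputable def spanningTrees [Fintype V] (Γ : SignedGraph V) : Finset (SimpleGraph V) :=
  (Set.toFinite {T : SimpleGraph V | T ≤ Γ.graph ∧ T.IsTree}).toFinset

/-- The set of spanning trees that contain the edge `e`. -/
noncomputable def spanningTreesWith [Fintype V] (Γ : SignedGraph V) (e : Γ.graph.edgeSet) :
    Finset (SimpleGraph V) :=
  open Classical in Γ.spanningTrees.filter fun T => (e : Sym2 V) ∈ T.edgeSet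

/-- The number `τ(Γ)` of spanning trees. -/
noncomputable def numSpanningTrees [Fintype V] (Γ : SignedGraph V) : ℕ := Γ.spanningTrees.card

/-- The factor `Ψ` of component sizes, for spanning trees `T`, `T'` that contain the edge `e`.
(Exactly one of the four cases applies.) -/
noncomputable def sizeFactor [LinearOrder V] (Γ : SignedGraph V)
    (N : Matrix V Γ.graph.edgeSet ℝ) (T T' : SimpleGraph V) (e : Γ.graph.edgeSet) (i j : V) : ℝ :=
  open Classical in
  if i ∈ Γ.tailComp N T e ∧ j ∈ Γ.tailComp N T' e then
    (Γ.headComp N T e).ncard * (Γ.headComp N T' e).ncard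
  else if i ∈ Γ.headComp N T e ∧ j ∈ Γ.headComp N T' e then
    (Γ.tailComp N T e).ncard * (Γ.tailComp N T' e).ncard
  else if i ∈ Γ.tailComp N T e ∧ j ∈ Γ.headComp N T' e then
    -((Γ.sign e : ℤ) : ℝ) * (Γ.headComp N T e).ncard * (Γ.tailComp N T' e).ncard
  else
    -((Γ.sign e : ℤ) : ℝ) * (Γ.tailComp N T e).ncard * (Γ.headComp N T' e).ncard

/-! #### The unbalanced case -/

/-- The component `c` of the subgraph `H` is a tree. -/
def IsTreeComponent (H : SimpleGraph V) (c : H.ConnectedComponent) : Prop :=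
  cyclesIn H c = ∅

/-- The component `c` of the subgraph `H` is an unbalanced unicyclic graph. -/
def IsUnbalancedUnicyclicComponent (Γ : SignedGraph V) (H : SimpleGraph V)
    (c : H.ConnectedComponent) : Prop :=
  ∃ C, cyclesIn H c = {C} ∧ ¬ Γ.IsBalancedCycle C

/-- `H` is a spanning `TU`-subgraph: each component is a tree or unbalanced unicyclic. -/
def IsSpanningTU (Γ : SignedGraph V) (H : SimpleGraph V) : Prop :=
  H ≤ Γ.graph ∧ ∀ c : H.ConnectedComponent,
    IsTreeComponent H c ∨ Γ.IsUnbalancedUnicyclicComponent H c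

/-- The number `c(H)` of unbalanced unicyclic components of `H`. -/
noncomputable def numUnicyclic (Γ : SignedGraph V) (H : SimpleGraph V) : ℕ :=
  {c : H.ConnectedComponent | Γ.IsUnbalancedUnicyclicComponent H c}.ncard

/-- The set of spanning `TU`-subgraphs with `n` edges, `n` being the number of vertices. -/
noncomputable def spanningTUs [Fintype V] (Γ : SignedGraph V) : Finset (SimpleGraph V) :=
  (Set.toFinite {H : SimpleGraph V |
    Γ.IsSpanningTU H ∧ H.edgeSet.ncard = Fintype.card V}).toFinset

/-- The set of spanning `TU`-subgraphs with `n` edges that contain the edge `e`. -/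
noncomputable def spanningTUsWith [Fintype V] (Γ : SignedGraph V) (e : Γ.graph.edgeSet) :
    Finset (SimpleGraph V) :=
  open Classical in Γ.spanningTUs.filter fun H => (e : Sym2 V) ∈ H.edgeSet

/-- With `U` the component of `H` that contains the end `u` of `e`, and `e` not on the cycle of
`U`: the vertices of the component of `U ∖ e` that contains the cycle of `U`. -/
def cycleSide (H : SimpleGraph V) (e : Sym2 V) (u : V) : Set V :=
  {j | ∃ C ∈ cyclesIn H (H.connectedComponentMk u), ∃ f ∈ C, ∃ v ∈ f, (del H e).Reachable v j}

/-- The combinatorial `(e, j)` entry for a spanning `TU`-subgraph `H` with `n` edges that contains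
the edge `e`; here `U` is the component of `H` that contains `e`. -/
noncomputable def tuEntry [LinearOrder V] (Γ : SignedGraph V) (N : Matrix V Γ.graph.edgeSet ℝ)
    (H : SimpleGraph V) (e : Γ.graph.edgeSet) (j : V) : ℝ :=
  open Classical in
  let U := H.connectedComponentMk (Γ.tail N e)
  if j ∉ U.supp then 0
  else if ∃ C ∈ cyclesIn H U, (e : Sym2 V) ∈ C then
    1 / 2 * Γ.pathSign (del H e) {Γ.tail N e} j
  else if j ∈ cycleSide H e (Γ.tail N e) then 0
  else if Γ.sign e = 1 ∧ j ∈ Γ.headComp N H e then -Γ.edgePathSign H e j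
  else Γ.edgePathSign H e j

end SignedGraph

/-! ### Moore–Penrose inverses: Gram matrices, averages of generalized inverses, dual bases. -/

section MoorePenroseLemmas

open Matrix

variable {m n : Type*} [Fintype m] [Fintype n]

/-! Since `L = N Nᵀ`, `moorePenrose_mul_transpose` reduces everything to `N†`, which is shown to be
a weighted average over bases: spanning trees with weight 1 if `Γ` is balanced, `TU`-subgraphs `H`
with `n` edges and weight `4 ^ c(H)` if not.

Let `Q` be the orthogonal projection on the column space of `N`; it is `1` in the unbalanced case
and `1 - s sᵀ / n` in the balanced case, with `s` a switching function. Each basis `B` gives a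
matrix `Z_B` with zero rows outside `B`, `N Z_B = Q` and `Z_B Q = Z_B`. These relations survive
averaging, so the only Penrose equation left is the symmetry of `X N` for the average `X`
(`isMoorePenroseInverse_averagedInverse`). It comes from basis exchange (`sum_dual_symm`): for `e`
in `B` and `f` outside, a nonzero entry `(Z_B N) e f` makes `B' = B - e + f` a basis, and `w(B) (Z_B
N) e f = w(B') (Z_B' N) f e`. The two entries are reciprocal, and `((Z_B N) e f) ^ 2 = w(B') /
w(B)`, since the weights play the role of squared determinants.

No determinants are computed. A vector orthogonal to the columns of a subgraph is a potential,
transported by the signs along its edges (`isPotential_iff`). Row `e` of `Z_B` is a potential on `B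
∖ e` normalized at `e` (`IsDualRow`); its values determine the squared entries (`sq_vecMul_mul_pow`,
`pow_exchange`, `treeRow_exchange`), and transport along paths gives the path signs in the formulas
(`dualRow_eq_tuEntry`, `treeRow_eq_treeTerm`). The bridge to combinatorics in the unbalanced case is
`mem_spanningTUs_iff`: the `TU`-subgraphs with `n` edges are those with `n` edges and no nonzero
potential. -/

theorem IsMoorePenroseInverse.moorePenrose_eq {A : Matrix m n ℝ} {X : Matrix n m ℝ}
    (hX : IsMoorePenroseInverse A X) : moorePenrose A = X :=
  (moorePenrose_spec A).unique hX

/-- The Moore–Penrose inverse of the Gram matrix `A Aᵀ`. -/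
theorem moorePenrose_mul_transpose (A : Matrix m n ℝ) :
    moorePenrose (A * Aᵀ) = (moorePenrose A)ᵀ * moorePenrose A := by
  obtain ⟨h1, h2, h3, h4⟩ := moorePenrose_spec A
  set X := moorePenrose A with hX
  have h5 : Aᵀ * Xᵀ = X * A := by rw [← transpose_mul, h4]
  have h6 : Xᵀ * Aᵀ = A * X := by rw [← transpose_mul, h3]
  have e1 : A * Aᵀ * (Xᵀ * X) = A * X := by
    rw [Matrix.mul_assoc A, ← Matrix.mul_assoc Aᵀ, h5, h2]
  have e2 : Xᵀ * X * (A * Aᵀ) = A * X := by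
    rw [Matrix.mul_assoc Xᵀ, ← Matrix.mul_assoc X, ← h5, Matrix.mul_assoc Aᵀ, h6,
      ← Matrix.mul_assoc, h6, ← Matrix.mul_assoc, h1]
  apply IsMoorePenroseInverse.moorePenrose_eq
  refine ⟨?_, ?_, ?_, ?_⟩
  · rw [e1, ← Matrix.mul_assoc, h1]
  · rw [e2, ← h6, Matrix.mul_assoc, ← Matrix.mul_assoc Aᵀ, h5, h2]
  · rw [e1, h3]
  · rw [e2, h3]

/-- A right inverse `X` of `A` modulo the orthogonal projection `Q` on the column space of `A`, for
which `X * A` is symmetric, is the Moore–Penrose inverse. -/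
theorem isMoorePenroseInverse_of_projection {A : Matrix m n ℝ} {X : Matrix n m ℝ}
    {Q : Matrix m m ℝ} (hQ : Qᵀ = Q) (hQA : Q * A = A) (hXQ : X * Q = X) (hAX : A * X = Q)
    (hXA : (X * A)ᵀ = X * A) : IsMoorePenroseInverse A X := by
  refine ⟨by rw [hAX, hQA], by rw [Matrix.mul_assoc, hAX, hXQ], by rw [hAX, hQ], hXA⟩

/-- The weighted average of the generalized inverses with rows `z b e`, for `b` in a family of
bases; row `e` of the inverse belonging to `b` vanishes if `e` is not in `b`. -/
noncomputable def averagedInverse {β : Type*} (B : Finset β) (w : β → ℝ)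
    (z : β → n → m → ℝ) : Matrix n m ℝ :=
  Matrix.of fun e i => (∑ b ∈ B, w b)⁻¹ * ∑ b ∈ B, w b * z b e i

/-- The conditions involving `Q` are linear in the rows and hold for each `b`. Symmetry of `X * A`
may fail for a single `b` and is required only of the weighted sum. -/
theorem isMoorePenroseInverse_averagedInverse {β : Type*} {A : Matrix m n ℝ} {Q : Matrix m m ℝ}
    (B : Finset β) (w : β → ℝ) (z : β → n → m → ℝ) (hw : ∑ b ∈ B, w b ≠ 0)
    (hQ : Qᵀ = Q) (hQA : Q * A = A) (hzQ : ∀ b ∈ B, ∀ e, z b e ᵥ* Q = z b e)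
    (hAz : ∀ b ∈ B, A * Matrix.of (z b) = Q)
    (hsymm : ∀ e f, ∑ b ∈ B, w b * (z b e ᵥ* A) f = ∑ b ∈ B, w b * (z b f ᵥ* A) e) :
    IsMoorePenroseInverse A (averagedInverse B w z) := by
  have hrow : averagedInverse B w z = (∑ b ∈ B, w b)⁻¹ • ∑ b ∈ B, w b • Matrix.of (z b) := by
    ext e i
    simp [averagedInverse, Matrix.sum_apply]
  have hmul : ∀ e f, (averagedInverse B w z * A) e f
      = (∑ b ∈ B, w b)⁻¹ * ∑ b ∈ B, w b * (z b e ᵥ* A) f := by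
    intro e f
    rw [hrow, Matrix.smul_mul, Matrix.sum_mul, Matrix.smul_apply, Matrix.sum_apply, smul_eq_mul]
    congr 1
    refine Finset.sum_congr rfl fun b _ => ?_
    rw [Matrix.smul_mul, Matrix.smul_apply, smul_eq_mul]
    rfl
  refine isMoorePenroseInverse_of_projection hQ hQA ?_ ?_ ?_
  · rw [hrow, Matrix.smul_mul, Matrix.sum_mul]
    congr 1
    refine Finset.sum_congr rfl fun b hb => ?_
    rw [Matrix.smul_mul]
    congr 1
    ext e i
    exact congrFun (hzQ b hb e) i
  · rw [hrow, Matrix.mul_smul, Matrix.mul_sum]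
    have : ∀ b ∈ B, A * w b • Matrix.of (z b) = w b • Q := fun b hb => by
      rw [Matrix.mul_smul, hAz b hb]
    rw [Finset.sum_congr rfl this, ← Finset.sum_smul, smul_smul, inv_mul_cancel₀ hw, one_smul]
  · ext e f
    rw [transpose_apply, hmul, hmul, hsymm]

/-- If the columns of `A` and the rows `z e` vanish outside `S`, the rows in `S` are dual to the
columns in `S` and `A` has trivial left kernel, then `z` is the Moore–Penrose inverse of `A`. -/
theorem isMoorePenroseInverse_of_dual [DecidableEq m] {A : Matrix m n ℝ} {z : n → m → ℝ} (S : Set n)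
    (hA : ∀ e ∉ S, ∀ i, A i e = 0) (hz : ∀ e ∉ S, z e = 0)
    (hdual : ∀ e ∈ S, (z e ᵥ* A) e = 1) (hdual' : ∀ e ∈ S, ∀ f ∈ S, f ≠ e → (z e ᵥ* A) f = 0)
    (hker : ∀ y : m → ℝ, (∀ e ∈ S, (y ᵥ* A) e = 0) → y = 0) :
    A * Matrix.of z = 1 ∧ IsMoorePenroseInverse A (Matrix.of z) := by
  classical
  have hAf : ∀ (y : m → ℝ), ∀ f ∉ S, (y ᵥ* A) f = 0 := fun y f hf => by
    simp [Matrix.vecMul, dotProduct, hA f hf]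
  have h1 : Matrix.of z * A = Matrix.diagonal fun e => if e ∈ S then 1 else 0 := by
    ext e f
    change (z e ᵥ* A) f = _
    by_cases he : e ∈ S
    · by_cases hef : f = e
      · subst hef; rw [hdual f he]; simp [he]
      · rw [diagonal_apply_ne _ (Ne.symm hef)]
        by_cases hf : f ∈ S
        · exact hdual' e he f hf hef
        · exact hAf _ f hf
    · rw [hz e he]
      by_cases hef : f = e
      · subst hef; simp [he]
      · rw [diagonal_apply_ne _ (Ne.symm hef)]; simp
  have hAd : A * (Matrix.diagonal fun e => if e ∈ S then (1 : ℝ) else 0) = A := by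
    ext i e
    rw [mul_diagonal]
    by_cases he : e ∈ S
    · simp [he]
    · simp [he, hA e he i]
  -- `of z * A` is the indicator of `S`, so `A * of z * A = A`. Hence the rows of `A * of z - 1` lie
  -- in the left kernel, which is trivial.
  have h2 : A * Matrix.of z = 1 := by
    apply Matrix.ext_of_single_vecMul
    intro i
    rw [← sub_eq_zero, ← Matrix.vecMul_sub]
    apply hker
    intro e _
    rw [Matrix.vecMul_vecMul, Matrix.sub_mul, Matrix.one_mul, Matrix.mul_assoc, h1, hAd, sub_self,
      Matrix.vecMul_zero]
    rfl
  refine ⟨h2, isMoorePenroseInverse_of_projection transpose_one (Matrix.one_mul _)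
    (Matrix.mul_one _) h2 ?_⟩
  rw [h1, diagonal_transpose]

end MoorePenroseLemmas

/-! ### Signs of walks, and potentials. -/

namespace SignedGraph

open SimpleGraph

variable {V : Type*}

theorem walkSign_nil (Γ : SignedGraph V) {F : SimpleGraph V} (u : V) :
    Γ.walkSign (Walk.nil : F.Walk u u) = 1 := rfl

theorem walkSign_cons (Γ : SignedGraph V) {F : SimpleGraph V} {u v w : V} (h : F.Adj u v)
    (p : F.Walk v w) : Γ.walkSign (Walk.cons h p) = Γ.edgeSign s(u, v) * Γ.walkSign p := by
  simp [walkSign]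

theorem walkSign_append (Γ : SignedGraph V) {F : SimpleGraph V} {u v w : V} (p : F.Walk u v)
    (q : F.Walk v w) : Γ.walkSign (p.append q) = Γ.walkSign p * Γ.walkSign q := by
  simp [walkSign]

theorem walkSign_reverse (Γ : SignedGraph V) {F : SimpleGraph V} {u v : V} (p : F.Walk u v) :
    Γ.walkSign p.reverse = Γ.walkSign p := by
  simp [walkSign, List.prod_reverse]

theorem isBalancedCycle_iff_walkSign (Γ : SignedGraph V) {F : SimpleGraph V} {u : V}
    {p : F.Walk u u} (hp : p.IsCycle) :
    Γ.IsBalancedCycle {e | e ∈ p.edges} ↔ Γ.walkSign p = 1 := by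
  classical
  have hset : {e ∈ {e | e ∈ p.edges} | Γ.edgeSign e = -1}
      = ((p.edges.filter fun e => Γ.edgeSign e = -1).toFinset : Set (Sym2 V)) := by
    ext e; simp
  have key : ∀ l : List (Sym2 V), (l.map Γ.edgeSign).prod
      = (-1) ^ (l.filter fun e => Γ.edgeSign e = -1).length := by
    intro l
    induction l with
    | nil => simp
    | cons e l ih =>
      rcases Int.units_eq_one_or (Γ.edgeSign e) with h | h
      · have : ¬ ((1 : ℤˣ) = -1) := by decide
        simp [h, ih, this]
      · simp [h, ih, pow_succ]
  rw [IsBalancedCycle, hset, Set.ncard_coe_finset, List.toFinset_card_of_nodup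
    (hp.isTrail.edges_nodup.filter _), walkSign, key]
  rcases Nat.even_or_odd (p.edges.filter fun e => Γ.edgeSign e = -1).length with h | h
  · simp [h]
  · rw [h.neg_one_pow]
    simp [Nat.not_even_iff_odd.2 h]

/-- If all cycles reachable from `u` are positive, every walk from `u` can be replaced by a path of
the same sign. -/
theorem exists_isPath_walkSign_eq (Γ : SignedGraph V) {F : SimpleGraph V} {u v : V}
    (p : F.Walk u v)
    (hF : ∀ (w : V) (c : F.Walk w w), F.Reachable u w → c.IsCycle → Γ.walkSign c = 1) :
    ∃ q : F.Walk u v, q.IsPath ∧ Γ.walkSign q = Γ.walkSign p := by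
  classical
  induction p with
  | nil => exact ⟨Walk.nil, Walk.IsPath.nil, rfl⟩
  | @cons u x v h p ih =>
    obtain ⟨q, hq, hqs⟩ := ih fun w c hw hc => hF w c (h.reachable.trans hw) hc
    by_cases hu : u ∈ q.support
    · refine ⟨q.dropUntil u hu, hq.dropUntil hu, ?_⟩
      -- The new edge followed by the path back to `u` is a cycle, unless that path is the same edge
      -- traversed backwards; then the sign is a square.
      have hclosed : Γ.walkSign (Walk.cons h (q.takeUntil u hu)) = 1 := by
        by_cases he : s(u, x) ∈ (q.takeUntil u hu).edges
        · have hpath := hq.takeUntil hu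
          generalize q.takeUntil u hu = r at he hpath ⊢
          cases r with
          | nil => simp at he
          | @cons _ y _ h' r =>
            rw [Walk.cons_isPath_iff] at hpath
            rw [Walk.edges_cons, List.mem_cons] at he
            rcases he with he | he
            · have hy : y = u := by
                rw [Sym2.eq_iff] at he
                rcases he with ⟨h1, h2⟩ | ⟨h1, h2⟩
                · exact absurd h1 h.ne
                · exact h1.symm
              subst hy
              rw [(Walk.isPath_iff_nil.1 hpath.1).eq_nil]
              rw [walkSign_cons, walkSign_cons, walkSign_nil, Sym2.eq_swap, mul_one, ← sq,
                Int.units_sq]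
            · exact absurd (Walk.snd_mem_support_of_mem_edges _ he) hpath.2
        · exact hF u _ (Reachable.refl u) ((Walk.cons_isCycle_iff _ h).2 ⟨hq.takeUntil hu, he⟩)
      have hsplit := walkSign_append Γ (q.takeUntil u hu) (q.dropUntil u hu)
      rw [Walk.take_spec] at hsplit
      rw [walkSign_cons] at hclosed ⊢
      rw [← hqs, hsplit, ← mul_assoc, hclosed, one_mul]
    · exact ⟨Walk.cons h q, (Walk.cons_isPath_iff h q).2 ⟨hq, hu⟩, by
        rw [walkSign_cons, walkSign_cons, hqs]⟩

theorem walkSign_closed_eq_one (Γ : SignedGraph V) {F : SimpleGraph V} {u : V} (p : F.Walk u u)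
    (hF : ∀ (w : V) (c : F.Walk w w), F.Reachable u w → c.IsCycle → Γ.walkSign c = 1) :
    Γ.walkSign p = 1 := by
  obtain ⟨q, hq, hqs⟩ := Γ.exists_isPath_walkSign_eq p hF
  rw [← hqs, (Walk.isPath_iff_nil.1 hq).eq_nil, walkSign_nil]

/-- `Γ.edgeSign` with real values. -/
noncomputable def realSign (Γ : SignedGraph V) (e : Sym2 V) : ℝ := ((Γ.edgeSign e : ℤ) : ℝ)

theorem units_cast_mul_self (x : ℤˣ) : ((x : ℤ) : ℝ) * ((x : ℤ) : ℝ) = 1 := by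
  rcases Int.units_eq_one_or x with h | h <;> simp [h]

/-- A function on the vertices that is transported by the signs along the edges of `F`. -/
def IsPotential (Γ : SignedGraph V) (F : SimpleGraph V) (y : V → ℝ) : Prop :=
  ∀ a b, F.Adj a b → y b = Γ.realSign s(a, b) * y a

theorem IsPotential.mono {Γ : SignedGraph V} {F F' : SimpleGraph V} {y : V → ℝ}
    (hy : Γ.IsPotential F y) (h : F' ≤ F) : Γ.IsPotential F' y :=
  fun a b hab => hy a b (h hab)

theorem IsPotential.transport {Γ : SignedGraph V} {F : SimpleGraph V} {y : V → ℝ}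
    (hy : Γ.IsPotential F y) {u v : V} (p : F.Walk u v) :
    y v = ((Γ.walkSign p : ℤ) : ℝ) * y u := by
  induction p with
  | nil => simp [walkSign_nil]
  | cons h p ih =>
    rw [ih, hy _ _ h, walkSign_cons, realSign]
    push_cast
    ring

theorem IsPotential.eq_zero_of_reachable {Γ : SignedGraph V} {F : SimpleGraph V} {y : V → ℝ}
    (hy : Γ.IsPotential F y) {u v : V} (h : F.Reachable u v) (hu : y u = 0) : y v = 0 := by
  obtain ⟨p⟩ := h
  rw [hy.transport p, hu, mul_zero]

theorem IsPotential.mul_self_eq {Γ : SignedGraph V} {F : SimpleGraph V} {y : V → ℝ}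
    (hy : Γ.IsPotential F y) {u v : V} (h : F.Reachable u v) : y v * y v = y u * y u := by
  obtain ⟨p⟩ := h
  rw [hy.transport p, mul_mul_mul_comm, units_cast_mul_self, one_mul]

/-- Transport around a closed walk of sign `-1` gives `y v = -y v`. -/
theorem IsPotential.eq_zero_of_walkSign {Γ : SignedGraph V} {F : SimpleGraph V} {y : V → ℝ}
    (hy : Γ.IsPotential F y) {u v : V} (h : F.Reachable u v) (c : F.Walk v v)
    (hc : Γ.walkSign c ≠ 1) : y u = 0 := by
  have h1 := hy.transport c
  rw [(Int.units_eq_one_or _).resolve_left hc] at h1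
  apply hy.eq_zero_of_reachable h.symm
  push_cast at h1
  linarith

/-- The indicator function of the component of `u`, with the signs of the walks from `u`. -/
noncomputable def componentPotential (Γ : SignedGraph V) (F : SimpleGraph V) (u : V) : V → ℝ :=
  open Classical in
  fun v => if h : F.Reachable u v then ((Γ.walkSign h.some : ℤ) : ℝ) else 0

theorem componentPotential_of_not_reachable (Γ : SignedGraph V) {F : SimpleGraph V} {u v : V}
    (h : ¬ F.Reachable u v) : Γ.componentPotential F u v = 0 := dif_neg h

/-- The chosen walk does not matter: two walks with the same ends close up to a walk of sign 1. -/
theorem componentPotential_eq (Γ : SignedGraph V) {F : SimpleGraph V} {u : V}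
    (hF : ∀ (w : V) (c : F.Walk w w), F.Reachable u w → c.IsCycle → Γ.walkSign c = 1)
    {v : V} (p : F.Walk u v) : Γ.componentPotential F u v = ((Γ.walkSign p : ℤ) : ℝ) := by
  have h : F.Reachable u v := ⟨p⟩
  rw [componentPotential, dif_pos h]
  have := Γ.walkSign_closed_eq_one (h.some.append p.reverse) hF
  rw [walkSign_append, walkSign_reverse] at this
  rw [mul_eq_one_iff_eq_inv.1 this, Int.units_inv_eq_self]

theorem componentPotential_self (Γ : SignedGraph V) {F : SimpleGraph V} {u : V}
    (hF : ∀ (w : V) (c : F.Walk w w), F.Reachable u w → c.IsCycle → Γ.walkSign c = 1) :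
    Γ.componentPotential F u u = 1 := by
  rw [Γ.componentPotential_eq hF Walk.nil, walkSign_nil]
  simp

theorem isPotential_componentPotential (Γ : SignedGraph V) {F : SimpleGraph V} {u : V}
    (hF : ∀ (w : V) (c : F.Walk w w), F.Reachable u w → c.IsCycle → Γ.walkSign c = 1) :
    Γ.IsPotential F (Γ.componentPotential F u) := by
  intro a b hab
  by_cases ha : F.Reachable u a
  · obtain ⟨p⟩ := ha
    rw [Γ.componentPotential_eq hF p, Γ.componentPotential_eq hF (p.append (Walk.cons hab Walk.nil)),
      walkSign_append, walkSign_cons, walkSign_nil, realSign]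
    push_cast
    ring
  · have hb : ¬ F.Reachable u b := fun h => ha (h.trans hab.symm.reachable)
    rw [componentPotential_of_not_reachable Γ ha, componentPotential_of_not_reachable Γ hb, mul_zero]

/-- The sign of a shortest path is the sign of some walk from the starting set. -/
theorem exists_pathSign_eq (Γ : SignedGraph V) (F : SimpleGraph V) (A : Set V) (j : V)
    (h : ∃ u ∈ A, F.Reachable u j) :
    ∃ (u : V) (p : F.Walk u j), u ∈ A ∧ Γ.pathSign F A j = ((Γ.walkSign p : ℤ) : ℝ) := by
  classical
  have hex : ∃ (u : V) (p : F.Walk u j), u ∈ A ∧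
      ∀ (u' : V) (q : F.Walk u' j), u' ∈ A → p.length ≤ q.length := by
    have hne : ∃ n, ∃ (u : V) (p : F.Walk u j), u ∈ A ∧ p.length = n := by
      obtain ⟨u, hu, ⟨p⟩⟩ := h
      exact ⟨_, u, p, hu, rfl⟩
    obtain ⟨u, p, hu, hp⟩ := Nat.find_spec hne
    exact ⟨u, p, hu, fun u' q hu' => hp ▸ Nat.find_min' hne ⟨u', q, hu', rfl⟩⟩
  exact ⟨hex.choose, hex.choose_spec.choose, hex.choose_spec.choose_spec.1, dif_pos hex⟩

/-- Path signs are read off from values of potentials, so the uniqueness of the path never has to be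
proved. -/
theorem IsPotential.exists_eq_pathSign_mul {Γ : SignedGraph V} {F : SimpleGraph V} {y : V → ℝ}
    (hy : Γ.IsPotential F y) (A : Set V) (j : V) (h : ∃ u ∈ A, F.Reachable u j) :
    ∃ u ∈ A, F.Reachable u j ∧ y j = Γ.pathSign F A j * y u := by
  obtain ⟨u, p, hu, hp⟩ := Γ.exists_pathSign_eq F A j h
  exact ⟨u, hu, ⟨p⟩, by rw [hp, hy.transport p]⟩

end SignedGraph

/-! ### Incidence matrices, exchange of edges, components of subgraphs. -/

namespace SignedGraph

open SimpleGraph Matrix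

variable {V : Type*}

theorem edgeSign_coe (Γ : SignedGraph V) (e : Γ.graph.edgeSet) :
    Γ.edgeSign (e : Sym2 V) = Γ.sign e := by
  rw [edgeSign, dif_pos e.2]

theorem realSign_coe (Γ : SignedGraph V) (e : Γ.graph.edgeSet) :
    Γ.realSign (e : Sym2 V) = ((Γ.sign e : ℤ) : ℝ) := by
  rw [realSign, edgeSign_coe]

variable {Γ : SignedGraph V} {N : Matrix V Γ.graph.edgeSet ℝ}

theorem edge_ne {e : Γ.graph.edgeSet} {a b : V} (he : (e : Sym2 V) = s(a, b)) : a ≠ b := by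
  have h := e.2
  rw [he, mem_edgeSet] at h
  exact h.ne

namespace IsIncidenceMatrix

theorem entry_mul_self (hN : Γ.IsIncidenceMatrix N) {e : Γ.graph.edgeSet} {i : V}
    (hi : i ∈ (e : Sym2 V)) : N i e * N i e = 1 := by
  rcases (hN e).2.1 i hi with h | h <;> rw [h] <;> norm_num

theorem entry_mul_entry (hN : Γ.IsIncidenceMatrix N) {e : Γ.graph.edgeSet} {a b : V}
    (he : (e : Sym2 V) = s(a, b)) : N a e * N b e = -Γ.realSign s(a, b) := by
  rw [(hN e).2.2 a b (by simp [he]) (by simp [he]) (edge_ne he), ← realSign_coe, he]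

variable [Fintype V]

theorem vecMul_apply (hN : Γ.IsIncidenceMatrix N) (y : V → ℝ) {e : Γ.graph.edgeSet} {a b : V}
    (he : (e : Sym2 V) = s(a, b)) : (y ᵥ* N) e = y a * N a e + y b * N b e := by
  classical
  refine Fintype.sum_eq_add a b (edge_ne he) fun x hx => ?_
  have h0 : N x e = 0 := (hN e).1 x (by simpa [he] using hx)
  simp [h0]

/-- The entries of a column are `±1` with product `-σ(e)`; multiplying the orthogonality relation by
one of them yields the transport rule. -/
theorem vecMul_eq_zero_iff (hN : Γ.IsIncidenceMatrix N) (y : V → ℝ) {e : Γ.graph.edgeSet}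
    {a b : V} (he : (e : Sym2 V) = s(a, b)) :
    (y ᵥ* N) e = 0 ↔ y b = Γ.realSign s(a, b) * y a := by
  have h1 := hN.entry_mul_entry he
  have h2 := hN.entry_mul_self (e := e) (i := b) (by simp [he])
  have h3 : Γ.realSign s(a, b) = -(N a e * N b e) := by rw [h1, neg_neg]
  rw [hN.vecMul_apply y he, h3]
  constructor
  · intro h
    linear_combination N b e * h - y b * h2
  · intro h
    linear_combination N b e * h - N a e * y a * h2

theorem isPotential_iff (hN : Γ.IsIncidenceMatrix N) {F : SimpleGraph V} (hF : F ≤ Γ.graph)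
    (y : V → ℝ) : Γ.IsPotential F y ↔
      ∀ e : Γ.graph.edgeSet, (e : Sym2 V) ∈ F.edgeSet → (y ᵥ* N) e = 0 := by
  constructor
  · rintro h ⟨e, he⟩ heF
    induction e using Sym2.ind with
    | _ a b => exact (hN.vecMul_eq_zero_iff y (e := ⟨s(a, b), he⟩) rfl).2 (h a b heF)
  · intro h a b hab
    exact (hN.vecMul_eq_zero_iff y (e := ⟨s(a, b), hF hab⟩) rfl).1 (h _ hab)

theorem laplacian_eq [DecidableEq V] [DecidableRel Γ.graph.Adj] (hN : Γ.IsIncidenceMatrix N) :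
    Γ.laplacian = N * N.transpose := by
  classical
  ext i j
  rw [laplacian, Matrix.sub_apply, Matrix.mul_apply, SimpleGraph.degMatrix, adjMatrix]
  simp only [Matrix.transpose_apply]
  by_cases hij : i = j
  · subst hij
    have h1 : ∀ e : Γ.graph.edgeSet, N i e * N i e = if i ∈ (e : Sym2 V) then 1 else 0 := by
      intro e
      split_ifs with h
      · exact hN.entry_mul_self h
      · rw [(hN e).1 i h, mul_zero]
    rw [Finset.sum_congr rfl fun e _ => h1 e]
    simp only [Matrix.diagonal_apply_eq, SimpleGraph.irrefl, if_false, sub_zero, Finset.sum_boole]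
    rw [← card_incidenceFinset_eq_degree]
    norm_cast
    symm
    refine Finset.card_bij (fun e _ => (e : Sym2 V)) ?_ ?_ ?_
    · intro e he
      rw [mem_incidenceFinset]
      exact ⟨e.2, (Finset.mem_filter.1 he).2⟩
    · intro e _ f _ h
      exact Subtype.ext h
    · intro e he
      rw [mem_incidenceFinset] at he
      exact ⟨⟨e, he.1⟩, by simpa using he.2, rfl⟩
  · rw [Matrix.diagonal_apply_ne _ hij, zero_sub]
    split_ifs with hadj
    · rw [Fintype.sum_eq_single (⟨s(i, j), hadj⟩ : Γ.graph.edgeSet)]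
      · rw [hN.entry_mul_entry rfl]
        rfl
      · intro e he
        by_cases hi : i ∈ (e : Sym2 V)
        · by_cases hj : j ∈ (e : Sym2 V)
          · exact absurd (Subtype.ext ((Sym2.mem_and_mem_iff hij).1 ⟨hi, hj⟩)) he
          · rw [(hN e).1 j hj, mul_zero]
        · rw [(hN e).1 i hi, zero_mul]
    · rw [neg_zero, eq_comm]
      refine Finset.sum_eq_zero fun e _ => ?_
      by_cases hi : i ∈ (e : Sym2 V)
      · by_cases hj : j ∈ (e : Sym2 V)
        · have h := e.2
          rw [(Sym2.mem_and_mem_iff hij).1 ⟨hi, hj⟩] at h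
          exact absurd h hadj
        · rw [(hN e).1 j hj, mul_zero]
      · rw [(hN e).1 i hi, zero_mul]

end IsIncidenceMatrix

theorem eq_zero_of_isPotential_of_not_balanced (hconn : Γ.graph.Connected) (hΓ : ¬ Γ.Balanced)
    (y : V → ℝ) (hy : Γ.IsPotential Γ.graph y) : y = 0 := by
  rw [Balanced] at hΓ
  push Not at hΓ
  obtain ⟨C, ⟨v, p, hp, rfl⟩, hC⟩ := hΓ
  rw [isBalancedCycle_iff_walkSign Γ hp] at hC
  funext u
  exact hy.eq_zero_of_walkSign (hconn.preconnected u v) p hC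

/-! ### Deleting, inserting and exchanging edges -/

theorem edgeSet_del (F : SimpleGraph V) (e : Sym2 V) : (del F e).edgeSet = F.edgeSet \ {e} :=
  edgeSet_deleteEdges _

theorem del_le (F : SimpleGraph V) (e : Sym2 V) : del F e ≤ F := deleteEdges_le _

theorem mem_edgeSet_del_of_notMem {H : SimpleGraph V} {u v : V} (p : H.Walk u v) {e : Sym2 V}
    (he : e ∉ p.edges) : ∀ f ∈ p.edges, f ∈ (del H e).edgeSet := by
  intro f hf
  rw [edgeSet_del]
  exact ⟨p.edges_subset_edgeSet hf, fun h => he (h ▸ hf)⟩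

theorem walkSign_transfer {H H' : SimpleGraph V} {u v : V} (p : H.Walk u v)
    (h : ∀ f ∈ p.edges, f ∈ H'.edgeSet) : Γ.walkSign (p.transfer H' h) = Γ.walkSign p := by
  rw [walkSign, Walk.edges_transfer, walkSign]

/-- The graph `F` with the edge `e` added. -/
def insertEdge (F : SimpleGraph V) (e : Sym2 V) : SimpleGraph V :=
  fromEdgeSet (insert e F.edgeSet)

theorem edgeSet_insertEdge (F : SimpleGraph V) {e : Sym2 V} (he : ¬ e.IsDiag) :
    (insertEdge F e).edgeSet = insert e F.edgeSet := by
  rw [insertEdge, edgeSet_fromEdgeSet]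
  ext x
  constructor
  · exact fun h => h.1
  · refine fun h => ⟨h, fun hx => ?_⟩
    rcases h with rfl | h
    · exact he hx
    · exact F.not_isDiag_of_mem_edgeSet h hx

theorem insertEdge_adj {F : SimpleGraph V} {e : Sym2 V} (he : ¬ e.IsDiag) {a b : V} :
    (insertEdge F e).Adj a b ↔ s(a, b) = e ∨ F.Adj a b := by
  rw [← mem_edgeSet, edgeSet_insertEdge F he]
  rfl

theorem le_insertEdge (F : SimpleGraph V) {e : Sym2 V} (he : ¬ e.IsDiag) : F ≤ insertEdge F e := by
  intro a b h
  exact (insertEdge_adj he).2 (Or.inr h)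

theorem insertEdge_del {F : SimpleGraph V} {e : Sym2 V} (he : e ∈ F.edgeSet) :
    insertEdge (del F e) e = F := by
  apply edgeSet_injective
  rw [edgeSet_insertEdge _ (F.not_isDiag_of_mem_edgeSet he), edgeSet_del, Set.insert_sdiff_singleton,
    Set.insert_eq_of_mem he]

theorem del_insertEdge {F : SimpleGraph V} {e : Sym2 V} (hd : ¬ e.IsDiag) (he : e ∉ F.edgeSet) :
    del (insertEdge F e) e = F := by
  apply edgeSet_injective
  rw [edgeSet_del, edgeSet_insertEdge _ hd, Set.insert_sdiff_of_mem _ (Set.mem_singleton e),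
    Set.sdiff_singleton_eq_self he]

theorem not_isDiag_edge (e : Γ.graph.edgeSet) : ¬ (e : Sym2 V).IsDiag :=
  Γ.graph.not_isDiag_of_mem_edgeSet e.2

theorem insertEdge_le {F : SimpleGraph V} (hF : F ≤ Γ.graph) (e : Γ.graph.edgeSet) :
    insertEdge F e ≤ Γ.graph := by
  intro a b h
  rcases (insertEdge_adj (not_isDiag_edge e)).1 h with h | h
  · rw [← mem_edgeSet, h]; exact e.2
  · exact hF h

/-- Replacing `e` by `f` in `H`. -/
def exchange (H : SimpleGraph V) (e f : Sym2 V) : SimpleGraph V := insertEdge (del H e) f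

theorem del_exchange {H : SimpleGraph V} {e f : Sym2 V} (hd : ¬ f.IsDiag) (hf : f ∉ H.edgeSet) :
    del (exchange H e f) f = del H e :=
  del_insertEdge hd fun h => hf (edgeSet_mono (del_le H e) h)

theorem exchange_exchange {H : SimpleGraph V} {e f : Sym2 V} (hd : ¬ f.IsDiag)
    (he : e ∈ H.edgeSet) (hf : f ∉ H.edgeSet) : exchange (exchange H e f) f e = H := by
  rw [exchange, del_exchange hd hf, insertEdge_del he]

theorem ncard_edgeSet_exchange [Finite V] {H : SimpleGraph V} {e f : Sym2 V} (hd : ¬ f.IsDiag)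
    (he : e ∈ H.edgeSet) (hf : f ∉ H.edgeSet) :
    (exchange H e f).edgeSet.ncard = H.edgeSet.ncard := by
  rw [exchange, edgeSet_insertEdge _ hd, edgeSet_del]
  exact Set.ncard_exchange hf he

theorem mem_exchange {H : SimpleGraph V} {e f : Sym2 V} (hd : ¬ f.IsDiag) :
    f ∈ (exchange H e f).edgeSet := by
  rw [exchange, edgeSet_insertEdge _ hd]
  exact Set.mem_insert _ _

/-- The exchange argument: a sum over bases of weighted dual rows is symmetric. -/
theorem sum_dual_symm [Fintype V] (B : Finset (SimpleGraph V)) (w : SimpleGraph V → ℝ)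
    (z : SimpleGraph V → Γ.graph.edgeSet → V → ℝ)
    (hzero : ∀ H ∈ B, ∀ e : Γ.graph.edgeSet, (e : Sym2 V) ∉ H.edgeSet → z H e = 0)
    (hdual : ∀ H ∈ B, ∀ e f : Γ.graph.edgeSet, (e : Sym2 V) ∈ H.edgeSet →
      (f : Sym2 V) ∈ H.edgeSet → f ≠ e → (z H e ᵥ* N) f = 0)
    (hex : ∀ H ∈ B, ∀ e f : Γ.graph.edgeSet, (e : Sym2 V) ∈ H.edgeSet →
      (f : Sym2 V) ∉ H.edgeSet → (z H e ᵥ* N) f ≠ 0 →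
      exchange H e f ∈ B ∧
      w H * (z H e ᵥ* N) f = w (exchange H e f) * (z (exchange H e f) f ᵥ* N) e)
    (e f : Γ.graph.edgeSet) :
    ∑ H ∈ B, w H * (z H e ᵥ* N) f = ∑ H ∈ B, w H * (z H f ᵥ* N) e := by
  rcases eq_or_ne f e with rfl | hfe
  · rfl
  have mem : ∀ {e f : Γ.graph.edgeSet} {H}, f ≠ e → H ∈ B → w H * (z H e ᵥ* N) f ≠ 0 →
      (e : Sym2 V) ∈ H.edgeSet ∧ (f : Sym2 V) ∉ H.edgeSet ∧ (z H e ᵥ* N) f ≠ 0 := by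
    intro e f H hfe hH h
    have h0 := right_ne_zero_of_mul h
    have he : (e : Sym2 V) ∈ H.edgeSet := by
      by_contra he
      rw [hzero H hH e he, Matrix.zero_vecMul] at h0
      exact h0 rfl
    exact ⟨he, fun hf => h0 (hdual H hH e f he hf hfe), h0⟩
  -- Nonzero terms have `e` in `H` and `f` outside. On these the exchange of `e` for `f` is a
  -- bijection onto the nonzero terms of the other sum, inverted by exchanging back.
  refine Finset.sum_bij_ne_zero (fun H _ _ => exchange H e f) ?_ ?_ ?_ ?_
  · intro H hH h
    obtain ⟨he, hf, h0⟩ := mem hfe hH h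
    exact (hex H hH e f he hf h0).1
  · intro H hH h H' hH' h' heq
    obtain ⟨he, hf, -⟩ := mem hfe hH h
    obtain ⟨he', hf', -⟩ := mem hfe hH' h'
    rw [← exchange_exchange (not_isDiag_edge f) he hf, heq,
      exchange_exchange (not_isDiag_edge f) he' hf']
  · intro H hH h
    obtain ⟨hf, he, h0⟩ := mem hfe.symm hH h
    obtain ⟨h1, h2⟩ := hex H hH f e hf he h0
    exact ⟨exchange H f e, h1, h2 ▸ h, exchange_exchange (not_isDiag_edge e) hf he⟩
  · intro H hH h
    obtain ⟨he, hf, h0⟩ := mem hfe hH h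
    exact (hex H hH e f he hf h0).2

theorem IsSpanningTU.cyclesIn_subsingleton {H : SimpleGraph V} (hH : Γ.IsSpanningTU H)
    (c : H.ConnectedComponent) : (cyclesIn H c).Subsingleton := by
  rcases hH.2 c with h | ⟨C, h, -⟩
  · rw [IsTreeComponent] at h
    rw [h]
    exact Set.subsingleton_empty
  · rw [h]
    exact Set.subsingleton_singleton

theorem IsSpanningTU.walkSign_cycle_ne_one {H : SimpleGraph V} (hH : Γ.IsSpanningTU H)
    {w : V} (p : H.Walk w w) (hp : p.IsCycle) : Γ.walkSign p ≠ 1 := by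
  have hmem : {e | e ∈ p.edges} ∈ cyclesIn H (H.connectedComponentMk w) := ⟨w, p, rfl, hp, rfl⟩
  rw [Ne, ← isBalancedCycle_iff_walkSign Γ hp]
  rcases hH.2 (H.connectedComponentMk w) with h | ⟨C, h, hC⟩
  · rw [IsTreeComponent] at h
    rw [h] at hmem
    exact absurd hmem (Set.notMem_empty _)
  · rw [h, Set.mem_singleton_iff] at hmem
    rwa [hmem]

/-- In a spanning `TU`-subgraph, deleting an edge leaves an end of it in a tree. -/
theorem IsSpanningTU.exists_end_not_reachable_cycle {H : SimpleGraph V} (hH : Γ.IsSpanningTU H)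
    {a b : V} (hab : H.Adj a b) :
    ∃ x ∈ s(a, b), ∀ (w : V) (c : (del H s(a, b)).Walk w w), (del H s(a, b)).Reachable x w →
      ¬ c.IsCycle := by
  classical
  by_contra hcon
  push Not at hcon
  obtain ⟨v, p, hv, hp⟩ := hcon a (Sym2.mem_mk_left a b)
  obtain ⟨w, q, hw, hq⟩ := hcon b (Sym2.mem_mk_right a b)
  have hle := del_le H s(a, b)
  have hp' := (Walk.isCycle_mapLe hle).2 hp
  have hq' := (Walk.isCycle_mapLe hle).2 hq
  have hpm : {e | e ∈ (p.mapLe hle).edges} ∈ cyclesIn H (H.connectedComponentMk a) :=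
    ⟨v, _, ConnectedComponent.sound (hv.mono hle).symm, hp', rfl⟩
  have hqm : {e | e ∈ (q.mapLe hle).edges} ∈ cyclesIn H (H.connectedComponentMk a) :=
    ⟨w, _, ConnectedComponent.sound (hab.reachable.trans (hw.mono hle)).symm, hq', rfl⟩
  -- Both cycles lie in one component of `H`, which has at most one cycle.
  have hedges : ∀ e, e ∈ p.edges → e ∈ q.edges := by
    intro e he
    have := hH.cyclesIn_subsingleton _ hpm hqm
    rw [Set.ext_iff] at this
    simpa using (this e).1 (by simpa using he)
  -- If `a` and `b` stay connected, the edge lies on a cycle, necessarily that of `p`, although `p`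
  -- avoids it. Otherwise the edges shared by `p` and `q` connect the two sides.
  by_cases hr : (del H s(a, b)).Reachable a b
  · obtain ⟨u, r, hrc, hre⟩ := adj_and_reachable_delete_edges_iff_exists_cycle.1 ⟨hab, hr⟩
    have hrm : {e | e ∈ r.edges} ∈ cyclesIn H (H.connectedComponentMk a) :=
      ⟨u, r, ConnectedComponent.sound
        ⟨r.takeUntil a (r.fst_mem_support_of_mem_edges hre)⟩, hrc, rfl⟩
    have := hH.cyclesIn_subsingleton _ hpm hrm
    rw [Set.ext_iff] at this
    have h1 := (this s(a, b)).2 hre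
    rw [Set.mem_ofPred_eq, Walk.edges_mapLe_eq_edges] at h1
    have h2 := p.edges_subset_edgeSet h1
    rw [edgeSet_del] at h2
    exact h2.2 rfl
  · cases p with
    | nil => exact hp.ne_nil rfl
    | cons h p =>
      have := q.fst_mem_support_of_mem_edges (hedges _ (by rw [Walk.edges_cons]; exact List.mem_cons_self))
      exact hr (hv.trans (hw.trans ⟨q.takeUntil v this⟩).symm)

/-! ### Counting components -/

theorem reachable_of_insertEdge {F : SimpleGraph V} {a b : V} (hab : a ≠ b)
    (h : F.Reachable a b) {u v : V} (huv : (insertEdge F s(a, b)).Reachable u v) :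
    F.Reachable u v := by
  obtain ⟨p⟩ := huv
  induction p with
  | nil => exact Reachable.refl _
  | cons hadj p ih =>
    refine Reachable.trans ?_ ih
    rcases (insertEdge_adj (by simpa using hab)).1 hadj with h' | h'
    · rcases Sym2.eq_iff.1 h' with ⟨rfl, rfl⟩ | ⟨rfl, rfl⟩
      · exact h
      · exact h.symm
    · exact h'.reachable

theorem reachable_del_of_reachable {H : SimpleGraph V} {a b : V} (hab : H.Adj a b)
    (h : (del H s(a, b)).Reachable a b) {u v : V} (huv : H.Reachable u v) :
    (del H s(a, b)).Reachable u v := by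
  rw [← insertEdge_del (F := H) (e := s(a, b)) hab] at huv
  exact reachable_of_insertEdge hab.ne h huv

theorem card_component_insertEdge_of_reachable {F : SimpleGraph V} {a b : V} (hab : a ≠ b)
    (h : F.Reachable a b) :
    Nat.card (insertEdge F s(a, b)).ConnectedComponent = Nat.card F.ConnectedComponent := by
  have hd : ¬ s(a, b).IsDiag := by simpa using hab
  symm
  refine Nat.card_congr (Equiv.ofBijective _ ⟨?_,
    ConnectedComponent.surjective_map_ofLE (le_insertEdge F hd)⟩)
  intro c d hcd
  induction c using ConnectedComponent.ind
  induction d using ConnectedComponent.ind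
  exact ConnectedComponent.sound (reachable_of_insertEdge hab h (ConnectedComponent.exact hcd))

theorem reachable_insertEdge_cases {F : SimpleGraph V} {a b : V} (hd : ¬ s(a, b).IsDiag) {u v : V}
    (huv : (insertEdge F s(a, b)).Reachable u v) : F.Reachable u v ∨
      (F.Reachable u a ∨ F.Reachable u b) ∧ (F.Reachable v a ∨ F.Reachable v b) := by
  obtain ⟨p⟩ := huv
  induction p with
  | nil => exact Or.inl (Reachable.refl _)
  | @cons x y v hadj p ih =>
    have hstep : F.Reachable x y ∨
        (F.Reachable x a ∨ F.Reachable x b) ∧ (F.Reachable y a ∨ F.Reachable y b) := by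
      rcases (insertEdge_adj hd).1 hadj with h' | h'
      · rcases Sym2.eq_iff.1 h' with ⟨rfl, rfl⟩ | ⟨rfl, rfl⟩
        · exact Or.inr ⟨Or.inl (Reachable.refl _), Or.inr (Reachable.refl _)⟩
        · exact Or.inr ⟨Or.inr (Reachable.refl _), Or.inl (Reachable.refl _)⟩
      · exact Or.inl h'.reachable
    rcases hstep with h1 | ⟨h1, h1'⟩
    · rcases ih with h2 | ⟨h2, h2'⟩
      · exact Or.inl (h1.trans h2)
      · exact Or.inr ⟨h2.imp h1.trans h1.trans, h2'⟩
    · rcases ih with h2 | ⟨-, h2'⟩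
      · exact Or.inr ⟨h1, h1'.imp h2.symm.trans h2.symm.trans⟩
      · exact Or.inr ⟨h1, h2'⟩

/-- A vertex of the component of an edge is connected to one of its ends without that edge. -/
theorem reachable_del_or {H : SimpleGraph V} {a b : V} (hab : H.Adj a b) {j : V}
    (hj : H.Reachable a j) : (del H s(a, b)).Reachable a j ∨ (del H s(a, b)).Reachable b j := by
  rw [← insertEdge_del (F := H) (e := s(a, b)) hab] at hj
  rcases reachable_insertEdge_cases (by simpa using hab.ne) hj with h | ⟨-, h⟩
  · exact Or.inl h
  · exact h.imp Reachable.symm Reachable.symm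

/-- The component of `b` merges into that of `a`; the components other than that of `b` correspond
bijectively to those of the larger graph. -/
theorem card_component_insertEdge_of_not_reachable [Finite V] {F : SimpleGraph V} {a b : V}
    (h : ¬ F.Reachable a b) :
    Nat.card (insertEdge F s(a, b)).ConnectedComponent + 1 = Nat.card F.ConnectedComponent := by
  have hd : ¬ s(a, b).IsDiag := by
    rw [Sym2.mk_isDiag_iff]
    rintro rfl
    exact h (Reachable.refl _)
  set φ := ConnectedComponent.map (Hom.ofLE (le_insertEdge F hd)) with hφ
  set cb := F.connectedComponentMk b with hcb
  have hinj : Set.InjOn φ {cb}ᶜ := by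
    intro c hc d hd' hcd
    induction c using ConnectedComponent.ind with | _ u =>
    induction d using ConnectedComponent.ind with | _ v =>
    have hu : ¬ F.Reachable u b := fun h => hc (ConnectedComponent.sound h)
    have hv : ¬ F.Reachable v b := fun h => hd' (ConnectedComponent.sound h)
    apply ConnectedComponent.sound
    rcases reachable_insertEdge_cases hd (ConnectedComponent.exact hcd) with h | ⟨h1, h2⟩
    · exact h
    · exact (h1.resolve_right hu).trans (h2.resolve_right hv).symm
  have himg : φ '' {cb}ᶜ = Set.univ := by
    ext c
    simp only [Set.mem_univ, iff_true]
    induction c using ConnectedComponent.ind with | _ u =>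
    by_cases hu : F.Reachable u b
    · refine ⟨F.connectedComponentMk a, fun h' => h (ConnectedComponent.exact h'), ?_⟩
      apply ConnectedComponent.sound
      have hadj : (insertEdge F s(a, b)).Adj a b := (insertEdge_adj hd).2 (Or.inl rfl)
      exact hadj.reachable.trans (hu.symm.mono (le_insertEdge F hd))
    · exact ⟨F.connectedComponentMk u, fun h' => hu (ConnectedComponent.exact h'), rfl⟩
  rw [← Set.ncard_univ, ← himg, hinj.ncard_image]
  have := Set.ncard_add_ncard_compl ({cb} : Set F.ConnectedComponent)
  rw [Set.ncard_singleton] at this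
  rw [add_comm, this]

end SignedGraph

/-! ### Dual rows, and the bases of the unbalanced case. -/

namespace SignedGraph

open SimpleGraph Matrix

variable {V : Type*} [Fintype V] {Γ : SignedGraph V} {N : Matrix V Γ.graph.edgeSet ℝ}

/-- `H` is a basis of the frame matroid of an unbalanced connected signed graph. -/
def IsNonsingular (Γ : SignedGraph V) (H : SimpleGraph V) : Prop :=
  H ≤ Γ.graph ∧ H.edgeSet.ncard = Fintype.card V ∧ ∀ y : V → ℝ, Γ.IsPotential H y → y = 0

/-- `z` is the row with index `e` of the inverse of the incidence matrix of `H`. -/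
def IsDualRow (Γ : SignedGraph V) (N : Matrix V Γ.graph.edgeSet ℝ) (H : SimpleGraph V)
    (e : Γ.graph.edgeSet) (z : V → ℝ) : Prop :=
  Γ.IsPotential (del H e) z ∧ (z ᵥ* N) e = 1

theorem vecMul_eq_zero_of_isPotential_del (hN : Γ.IsIncidenceMatrix N) {H : SimpleGraph V}
    (hH : H ≤ Γ.graph) {e f : Γ.graph.edgeSet} {z : V → ℝ} (hz : Γ.IsPotential (del H e) z)
    (hf : (f : Sym2 V) ∈ H.edgeSet) (hfe : f ≠ e) : (z ᵥ* N) f = 0 := by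
  refine (hN.isPotential_iff ((del_le H e).trans hH) z).1 hz f ?_
  rw [edgeSet_del]
  exact ⟨hf, fun h => hfe (Subtype.ext h)⟩

theorem isPotential_of_del (hN : Γ.IsIncidenceMatrix N) {H : SimpleGraph V} (hH : H ≤ Γ.graph)
    {e : Γ.graph.edgeSet} {z : V → ℝ} (hz : Γ.IsPotential (del H e) z) (he : (z ᵥ* N) e = 0) :
    Γ.IsPotential H z := by
  rw [hN.isPotential_iff hH]
  intro f hf
  by_cases hfe : f = e
  · rw [hfe, he]
  · exact vecMul_eq_zero_of_isPotential_del hN hH hz hf hfe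

theorem exists_isDualRow_of_ne_zero {H : SimpleGraph V} {e : Γ.graph.edgeSet} {y : V → ℝ}
    (hy : Γ.IsPotential (del H e) y) (hye : (y ᵥ* N) e ≠ 0) : ∃ z, Γ.IsDualRow N H e z := by
  refine ⟨((y ᵥ* N) e)⁻¹ • y, fun a b hab => ?_, ?_⟩
  · simp only [Pi.smul_apply, smul_eq_mul]
    rw [hy a b hab]
    ring
  · rw [Matrix.smul_vecMul, Pi.smul_apply, smul_eq_mul, inv_mul_cancel₀ hye]

/-- Multiplication with the columns of `N` that belong to edges of `H`. -/
noncomputable def edgeMap (N : Matrix V Γ.graph.edgeSet ℝ) (H : SimpleGraph V) :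
    (V → ℝ) →ₗ[ℝ] ({e : Γ.graph.edgeSet // (e : Sym2 V) ∈ H.edgeSet} → ℝ) :=
  LinearMap.funLeft ℝ ℝ Subtype.val ∘ₗ N.vecMulLinear

theorem edgeMap_apply (H : SimpleGraph V) (y : V → ℝ)
    (s : {e : Γ.graph.edgeSet // (e : Sym2 V) ∈ H.edgeSet}) : edgeMap N H y s = (y ᵥ* N) s.1 := rfl

theorem finrank_edgeMap_codomain {H : SimpleGraph V} (hH : H ≤ Γ.graph) :
    Module.finrank ℝ ({e : Γ.graph.edgeSet // (e : Sym2 V) ∈ H.edgeSet} → ℝ) = H.edgeSet.ncard := by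
  classical
  rw [Module.finrank_fintype_fun_eq_card, ← Nat.card_eq_fintype_card, ← Nat.card_coe_set_eq]
  exact Nat.card_congr ⟨fun s => ⟨s.1, s.2⟩, fun e => ⟨⟨e.1, edgeSet_mono hH e.2⟩, e.2⟩,
    fun _ => rfl, fun _ => rfl⟩

theorem edgeMap_injective_iff (hN : Γ.IsIncidenceMatrix N) {H : SimpleGraph V}
    (hH : H ≤ Γ.graph) :
    Function.Injective (edgeMap N H) ↔ ∀ y : V → ℝ, Γ.IsPotential H y → y = 0 := by
  rw [injective_iff_map_eq_zero]
  refine forall_congr' fun y => ?_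
  rw [hN.isPotential_iff hH]
  exact imp_congr_left ⟨fun h e he => congrFun h ⟨e, he⟩, fun h => funext fun s => h s.1 s.2⟩

/-- Dual rows are exactly the preimages of the standard basis vectors. -/
theorem edgeMap_surjective_iff (hN : Γ.IsIncidenceMatrix N) {H : SimpleGraph V}
    (hH : H ≤ Γ.graph) :
    Function.Surjective (edgeMap N H) ↔
      ∀ e : Γ.graph.edgeSet, (e : Sym2 V) ∈ H.edgeSet → ∃ z, Γ.IsDualRow N H e z := by
  classical
  constructor
  · intro h e he
    obtain ⟨z, hz⟩ := h (Pi.single ⟨e, he⟩ 1)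
    refine ⟨z, (hN.isPotential_iff ((del_le H e).trans hH) z).2 fun f hf => ?_, ?_⟩
    · rw [edgeSet_del] at hf
      have := congrFun hz ⟨f, hf.1⟩
      rwa [edgeMap_apply, Pi.single_eq_of_ne] at this
      intro hfe
      exact hf.2 (Subtype.ext_iff.1 (Subtype.ext_iff.1 hfe))
    · have := congrFun hz ⟨e, he⟩
      rwa [edgeMap_apply, Pi.single_eq_same] at this
  · intro h
    choose z hz using h
    intro y
    refine ⟨∑ s, y s • z s.1 s.2, ?_⟩
    have hsingle : ∀ s : {e : Γ.graph.edgeSet // (e : Sym2 V) ∈ H.edgeSet},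
        edgeMap N H (z s.1 s.2) = Pi.single s 1 := by
      intro s
      ext t
      rw [edgeMap_apply]
      by_cases hts : t = s
      · subst hts
        rw [Pi.single_eq_same, (hz t.1 t.2).2]
      · rw [Pi.single_eq_of_ne hts]
        exact vecMul_eq_zero_of_isPotential_del hN hH (hz s.1 s.2).1 t.2
          fun h => hts (Subtype.ext h)
    rw [map_sum]
    simp_rw [map_smul, hsingle]
    ext t
    rw [Finset.sum_apply, Fintype.sum_eq_single t fun s hs => by simp [Ne.symm hs]]
    simp

/-- With `n` edges the map is between spaces of equal dimension, so it is injective if and only if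
it is surjective. -/
theorem eq_zero_iff_exists_isDualRow (hN : Γ.IsIncidenceMatrix N) {H : SimpleGraph V}
    (hH : H ≤ Γ.graph) (hcard : H.edgeSet.ncard = Fintype.card V) :
    (∀ y : V → ℝ, Γ.IsPotential H y → y = 0) ↔
      ∀ e : Γ.graph.edgeSet, (e : Sym2 V) ∈ H.edgeSet → ∃ z, Γ.IsDualRow N H e z := by
  rw [← edgeMap_injective_iff hN hH, ← edgeMap_surjective_iff hN hH]
  apply LinearMap.injective_iff_surjective_of_finrank_eq_finrank
  rw [finrank_edgeMap_codomain hH, hcard, Module.finrank_fintype_fun_eq_card]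

namespace IsNonsingular

theorem exists_isDualRow (hN : Γ.IsIncidenceMatrix N) {H : SimpleGraph V} (hH : Γ.IsNonsingular H)
    (e : Γ.graph.edgeSet) (he : (e : Sym2 V) ∈ H.edgeSet) : ∃ z, Γ.IsDualRow N H e z :=
  (eq_zero_iff_exists_isDualRow hN hH.1 hH.2.1).1 hH.2.2 e he

/-- The potentials on `H ∖ e` form the line spanned by the dual row: subtracting the right multiple
leaves a potential on all of `H`. -/
theorem isDualRow_unique (hN : Γ.IsIncidenceMatrix N) {H : SimpleGraph V} (hH : Γ.IsNonsingular H)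
    {e : Γ.graph.edgeSet} {y z : V → ℝ} (hy : Γ.IsPotential (del H e) y)
    (hz : Γ.IsDualRow N H e z) : y = (y ᵥ* N) e • z := by
  rw [← sub_eq_zero]
  apply hH.2.2
  apply isPotential_of_del hN hH.1 (e := e)
  · intro a b hab
    simp only [Pi.sub_apply, Pi.smul_apply, smul_eq_mul]
    rw [hy a b hab, hz.1 a b hab]
    ring
  · rw [Matrix.sub_vecMul, Matrix.smul_vecMul, Pi.sub_apply, Pi.smul_apply, hz.2]
    simp

/-- A dual row lives on one component of `H ∖ e`. -/
theorem reachable_of_isDualRow (hN : Γ.IsIncidenceMatrix N) {H : SimpleGraph V}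
    (hH : Γ.IsNonsingular H) {e : Γ.graph.edgeSet} {z : V → ℝ} (hz : Γ.IsDualRow N H e z)
    {u v : V} (hu : z u ≠ 0) (hv : z v ≠ 0) : (del H e).Reachable u v := by
  classical
  by_contra huv
  -- Cutting `z` off outside the component of `u` gives a potential on `H ∖ e`, hence a multiple of
  -- `z`: the factor is 1 by the value at `u`, and 0 by the value at `v`.
  let y : V → ℝ := fun x => if (del H e).Reachable u x then z x else 0
  have hy : Γ.IsPotential (del H e) y := by
    intro a b hab
    by_cases ha : (del H e).Reachable u a
    · have hb : (del H e).Reachable u b := ha.trans hab.reachable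
      simp only [y, if_pos ha, if_pos hb]
      exact hz.1 a b hab
    · have hb : ¬ (del H e).Reachable u b := fun h => ha (h.trans hab.symm.reachable)
      simp [y, if_neg ha, if_neg hb]
  have h := hH.isDualRow_unique hN hy hz
  have h1 := congrFun h u
  have h2 := congrFun h v
  simp only [y, if_pos (Reachable.refl u), if_neg huv, Pi.smul_apply, smul_eq_mul] at h1 h2
  rcases mul_eq_zero.1 h2.symm with h3 | h3
  · rw [h3, zero_mul] at h1
    exact hu h1
  · exact hv h3

/-- On a tree component the signs of the walks from a root form a nonzero potential. -/
theorem not_isTreeComponent {H : SimpleGraph V}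
    (hH : Γ.IsNonsingular H) (c : H.ConnectedComponent) : ¬ IsTreeComponent H c := by
  intro hc
  induction c using ConnectedComponent.ind with | _ u =>
  have hF : ∀ (w : V) (p : H.Walk w w), H.Reachable u w → p.IsCycle → Γ.walkSign p = 1 := by
    intro w p hw hp
    have hmem : {e | e ∈ p.edges} ∈ cyclesIn H (H.connectedComponentMk u) :=
      ⟨w, p, ConnectedComponent.sound hw.symm, hp, rfl⟩
    rw [hc] at hmem
    exact absurd hmem (Set.notMem_empty _)
  have := hH.2.2 _ (Γ.isPotential_componentPotential hF)
  have h1 := Γ.componentPotential_self hF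
  rw [this] at h1
  exact zero_ne_one h1

/-- Let `e` be an edge of a positive cycle. Transport along the rest of the cycle forces every
potential on `H ∖ e` to vanish on column `e`, so `e` has no dual row. -/
theorem walkSign_cycle_ne_one (hN : Γ.IsIncidenceMatrix N) {H : SimpleGraph V}
    (hH : Γ.IsNonsingular H) {w : V} (p : H.Walk w w) (hp : p.IsCycle) : Γ.walkSign p ≠ 1 := by
  intro hsign
  cases p with
  | nil => exact hp.ne_nil rfl
  | @cons _ x _ h q =>
    obtain ⟨-, hq⟩ := (Walk.cons_isCycle_iff q h).1 hp
    let e : Γ.graph.edgeSet := ⟨s(w, x), hH.1 h⟩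
    obtain ⟨z, hz, hze⟩ := hH.exists_isDualRow hN e h
    have htr := hz.transport (q.transfer (del H e) (mem_edgeSet_del_of_notMem q hq))
    rw [walkSign_transfer] at htr
    have h0 : (z ᵥ* N) e = 0 := by
      rw [hN.vecMul_eq_zero_iff z (e := e) rfl, htr, ← mul_assoc, realSign, ← Int.cast_mul,
        ← Units.val_mul, ← walkSign_cons Γ h q, hsign]
      simp
    rw [h0] at hze
    exact zero_ne_one hze

/-- Suppose `e` is on `p` but not on `q`. Without `e` its ends are still connected to the negative
cycle `q`, so the dual row of `e` vanishes at both ends, against its normalization. -/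
theorem edges_subset_of_isCycle (hN : Γ.IsIncidenceMatrix N) {H : SimpleGraph V}
    (hH : Γ.IsNonsingular H) {v w : V} (p : H.Walk v v) (hp : p.IsCycle) (q : H.Walk w w)
    (hq : q.IsCycle) (hvw : H.Reachable v w) {e : Sym2 V} (he : e ∈ p.edges) : e ∈ q.edges := by
  classical
  by_contra heq
  induction e using Sym2.ind with | _ a b =>
  obtain ⟨hab, hr⟩ := adj_and_reachable_delete_edges_iff_exists_cycle.2 ⟨v, p, hp, he⟩
  obtain ⟨z, hz, hze⟩ := hH.exists_isDualRow hN ⟨s(a, b), hH.1 hab⟩ hab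
  have hva : H.Reachable v a := ⟨p.takeUntil a (p.fst_mem_support_of_mem_edges he)⟩
  have hsign : Γ.walkSign (q.transfer (del H s(a, b)) (mem_edgeSet_del_of_notMem q heq)) ≠ 1 := by
    rw [walkSign_transfer]
    exact hH.walkSign_cycle_ne_one hN q hq
  have haw := reachable_del_of_reachable hab hr (hva.symm.trans hvw)
  have ha : z a = 0 := hz.eq_zero_of_walkSign haw _ hsign
  have hb : z b = 0 := hz.eq_zero_of_walkSign (hr.symm.trans haw) _ hsign
  rw [hN.vecMul_apply z rfl, ha, hb] at hze
  simp at hze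

theorem isUnbalancedUnicyclicComponent (hN : Γ.IsIncidenceMatrix N) {H : SimpleGraph V}
    (hH : Γ.IsNonsingular H) (c : H.ConnectedComponent) :
    Γ.IsUnbalancedUnicyclicComponent H c := by
  obtain ⟨C, hC⟩ := Set.nonempty_iff_ne_empty.2 (hH.not_isTreeComponent c)
  refine ⟨C, Set.eq_singleton_iff_unique_mem.2 ⟨hC, ?_⟩, ?_⟩
  · rintro C' ⟨w, q, hw, hq, rfl⟩
    obtain ⟨v, p, hv, hp, rfl⟩ := hC
    have hvw : H.Reachable v w := ConnectedComponent.exact (hv.trans hw.symm)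
    ext e
    exact ⟨hH.edges_subset_of_isCycle hN q hq p hp hvw.symm,
      hH.edges_subset_of_isCycle hN p hp q hq hvw⟩
  · obtain ⟨v, p, hv, hp, rfl⟩ := hC
    rw [isBalancedCycle_iff_walkSign Γ hp]
    exact hH.walkSign_cycle_ne_one hN p hp

theorem numUnicyclic_eq (hN : Γ.IsIncidenceMatrix N) {H : SimpleGraph V}
    (hH : Γ.IsNonsingular H) : Γ.numUnicyclic H = Nat.card H.ConnectedComponent := by
  rw [numUnicyclic, ← Set.ncard_univ]
  congr 1
  ext c
  simpa using hH.isUnbalancedUnicyclicComponent hN c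

end IsNonsingular

/-- Some end `x` of `e` lies in a tree of `H ∖ e`, whose signed indicator `y` is a potential there.
If `y` vanished on column `e`, it would be a potential on `H`. Then `y x = 0`, either because `e`
lies on an unbalanced cycle or because `y` is zero at the other end; but `y x = 1`. -/
theorem IsSpanningTU.exists_isDualRow (hN : Γ.IsIncidenceMatrix N) {H : SimpleGraph V}
    (hH : Γ.IsSpanningTU H) (e : Γ.graph.edgeSet) (he : (e : Sym2 V) ∈ H.edgeSet) :
    ∃ z, Γ.IsDualRow N H e z := by
  classical
  obtain ⟨e, heG⟩ := e
  induction e using Sym2.ind with | _ a b =>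
  have hab : H.Adj a b := he
  obtain ⟨x, hx, hnc⟩ := hH.exists_end_not_reachable_cycle hab
  have hF : ∀ (w : V) (c : (del H s(a, b)).Walk w w), (del H s(a, b)).Reachable x w →
      c.IsCycle → Γ.walkSign c = 1 := fun w c hw hc => absurd hc (hnc w c hw)
  have hy := Γ.isPotential_componentPotential hF
  have hyx := Γ.componentPotential_self hF
  refine exists_isDualRow_of_ne_zero hy fun h0 => ?_
  have hyH := isPotential_of_del hN hH.1 hy h0
  have hxa : H.Reachable x a := by
    rcases Sym2.mem_iff.1 hx with rfl | rfl
    · exact Reachable.refl _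
    · exact hab.symm.reachable
  have key : Γ.componentPotential (del H s(a, b)) x x = 0 := by
    by_cases hr : (del H s(a, b)).Reachable a b
    · obtain ⟨u, r, hrc, hre⟩ := adj_and_reachable_delete_edges_iff_exists_cycle.1 ⟨hab, hr⟩
      exact hyH.eq_zero_of_walkSign
        (hxa.trans ⟨(r.takeUntil a (r.fst_mem_support_of_mem_edges hre)).reverse⟩) r
        (hH.walkSign_cycle_ne_one r hrc)
    · rcases Sym2.mem_iff.1 hx with rfl | rfl
      · exact hyH.eq_zero_of_reachable hab.symm.reachable (componentPotential_of_not_reachable Γ hr)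
      · exact hyH.eq_zero_of_reachable hab.reachable
          (componentPotential_of_not_reachable Γ fun h => hr h.symm)
  rw [hyx] at key
  exact one_ne_zero key

/-- Dual rows give one direction. In the other every component turns out to be unicyclic, so tree
components do not occur when there are `n` edges. -/
theorem mem_spanningTUs_iff (hN : Γ.IsIncidenceMatrix N) {H : SimpleGraph V} :
    H ∈ Γ.spanningTUs ↔ Γ.IsNonsingular H := by
  rw [spanningTUs, Set.Finite.mem_toFinset]
  constructor
  · rintro ⟨hTU, hcard⟩
    exact ⟨hTU.1, hcard, (eq_zero_iff_exists_isDualRow hN hTU.1 hcard).2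
      fun e he => hTU.exists_isDualRow hN e he⟩
  · intro h
    exact ⟨⟨h.1, fun c => Or.inr (h.isUnbalancedUnicyclicComponent hN c)⟩, h.2.1⟩

/-- A spanning subgraph without nonzero potentials exists if the graph is connected and
unbalanced. -/
theorem exists_isNonsingular (hN : Γ.IsIncidenceMatrix N)
    (hker : ∀ y : V → ℝ, Γ.IsPotential Γ.graph y → y = 0) : ∃ H, Γ.IsNonsingular H := by
  obtain ⟨H, hH⟩ := (Set.toFinite {H : SimpleGraph V | H ≤ Γ.graph ∧
    ∀ y : V → ℝ, Γ.IsPotential H y → y = 0}).exists_minimal ⟨Γ.graph, le_rfl, hker⟩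
  refine ⟨H, hH.prop.1, ?_, hH.prop.2⟩
  -- By minimality, deleting `e` creates a nonzero potential. It cannot vanish on column `e`, so it
  -- rescales to a dual row. Bijectivity then yields the edge count.
  have hsurj : Function.Surjective (edgeMap N H) := by
    rw [edgeMap_surjective_iff hN hH.prop.1]
    intro e he
    have hnot : ¬ ∀ y : V → ℝ, Γ.IsPotential (del H e) y → y = 0 := by
      intro h
      have := edgeSet_mono (hH.le_of_le ⟨(del_le H e).trans hH.prop.1, h⟩ (del_le H e)) he
      rw [edgeSet_del] at this
      exact this.2 rfl
    push Not at hnot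
    obtain ⟨y, hy, hy0⟩ := hnot
    exact exists_isDualRow_of_ne_zero hy
      fun h0 => hy0 (hH.prop.2 y (isPotential_of_del hN hH.prop.1 hy h0))
  have := (LinearEquiv.ofBijective _ ⟨(edgeMap_injective_iff hN hH.prop.1).2 hH.prop.2,
    hsurj⟩).finrank_eq
  rw [finrank_edgeMap_codomain hH.prop.1, Module.finrank_fintype_fun_eq_card] at this
  exact this.symm

end SignedGraph

/-! ### The weights `4 ^ c(H)` under exchange, and `N†` in the unbalanced case. -/

namespace SignedGraph

open SimpleGraph Matrix

variable {V : Type*} [Fintype V] {Γ : SignedGraph V} {N : Matrix V Γ.graph.edgeSet ℝ}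

/-- The number of components after adding an edge, from the value of a potential on it. -/
theorem IsPotential.sq_vecMul_mul_pow (hN : Γ.IsIncidenceMatrix N) {F : SimpleGraph V} {z : V → ℝ}
    (hz : Γ.IsPotential F z) (hsupp : ∀ u v, z u ≠ 0 → z v ≠ 0 → F.Reachable u v)
    {x : V} (hx : z x ≠ 0) {g : Γ.graph.edgeSet} (hg : (z ᵥ* N) g ≠ 0) :
    ((z ᵥ* N) g) ^ 2 * 4 ^ Nat.card F.ConnectedComponent =
      4 * (z x) ^ 2 * 4 ^ Nat.card (insertEdge F g).ConnectedComponent := by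
  obtain ⟨⟨a, b⟩, hgG⟩ := g
  change ((z ᵥ* N) ⟨s(a, b), hgG⟩) ^ 2 * 4 ^ Nat.card F.ConnectedComponent =
      4 * (z x) ^ 2 * 4 ^ Nat.card (insertEdge F s(a, b)).ConnectedComponent
  change (z ᵥ* N) ⟨s(a, b), hgG⟩ ≠ 0 at hg
  rw [hN.vecMul_apply z rfl] at hg ⊢
  have hNa : N a ⟨s(a, b), hgG⟩ * N a ⟨s(a, b), hgG⟩ = 1 :=
    hN.entry_mul_self (Sym2.mem_mk_left a b)
  have hNb : N b ⟨s(a, b), hgG⟩ * N b ⟨s(a, b), hgG⟩ = 1 :=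
    hN.entry_mul_self (Sym2.mem_mk_right a b)
  generalize N a ⟨s(a, b), hgG⟩ = α at *
  generalize N b ⟨s(a, b), hgG⟩ = β at *
  -- The absolute value of `z` is constant on its support. If `g` stays within a component, its ends
  -- contribute equally, the square is `4 * z x ^ 2` and the number of components is unchanged.
  -- Otherwise only one end contributes, the square is `z x ^ 2`, and losing a component supplies
  -- the factor 4.
  by_cases hr : F.Reachable a b
  · rw [card_component_insertEdge_of_reachable (SimpleGraph.Adj.ne hgG) hr]
    have hab := hz.mul_self_eq hr
    have ha : z a ≠ 0 := fun ha => hg (by rw [hz.eq_zero_of_reachable hr ha, ha]; ring)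
    have hax := hz.mul_self_eq (hsupp a x ha hx)
    have heq : z a * α = z b * β := by
      have : (z a * α - z b * β) * (z a * α + z b * β) = 0 := by
        linear_combination z a * z a * hNa - z b * z b * hNb - hab
      rcases mul_eq_zero.1 this with h | h
      · linarith
      · exact absurd h hg
    rw [← heq]
    have : (z a * α + z a * α) ^ 2 = 4 * z x ^ 2 := by
      linear_combination 4 * z a * z a * hNa - 4 * hax
    rw [this]
  · rw [← card_component_insertEdge_of_not_reachable hr]
    have hsq : (z a * α + z b * β) ^ 2 = z x ^ 2 := by
      by_cases ha : z a = 0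
      · have hb : z b ≠ 0 := fun hb => hg (by rw [ha, hb]; ring)
        have hbx := hz.mul_self_eq (hsupp b x hb hx)
        rw [ha]
        linear_combination z b * z b * hNb - hbx
      · have hb : z b = 0 := by
          by_contra hb
          exact hr (hsupp a b ha hb)
        have hax := hz.mul_self_eq (hsupp a x ha hx)
        rw [hb]
        linear_combination z a * z a * hNa - hax
    rw [hsq]
    ring

namespace IsNonsingular

/-- A potential on the exchanged graph is a multiple of `z`, and it must vanish on column `f`, where
`z` does not. -/
theorem exchange_isNonsingular (hN : Γ.IsIncidenceMatrix N) {H : SimpleGraph V}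
    (hH : Γ.IsNonsingular H) {e f : Γ.graph.edgeSet} (he : (e : Sym2 V) ∈ H.edgeSet)
    (hf : (f : Sym2 V) ∉ H.edgeSet) {z : V → ℝ} (hz : Γ.IsDualRow N H e z)
    (hzf : (z ᵥ* N) f ≠ 0) : Γ.IsNonsingular (exchange H e f) := by
  have hle := insertEdge_le ((del_le H e).trans hH.1) f
  refine ⟨hle, by rw [ncard_edgeSet_exchange (not_isDiag_edge f) he hf, hH.2.1], fun y hy => ?_⟩
  have h := hH.isDualRow_unique hN (hy.mono (le_insertEdge (del H e) (not_isDiag_edge f))) hz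
  have h0 := (hN.isPotential_iff hle y).1 hy f (mem_exchange (not_isDiag_edge f))
  rw [h, Matrix.smul_vecMul, Pi.smul_apply, smul_eq_mul] at h0
  rw [h, (mul_eq_zero.1 h0).resolve_right hzf, zero_smul]

/-- Applying `sq_vecMul_mul_pow` to `H ∖ e` with both `e` and `f` gives `4 ^ c(H) * ((z ᵥ* N) f) ^ 2
= 4 ^ c(H')`, with `H'` the exchanged graph. Since `z'` is a multiple of `z`, the two entries are
reciprocal, so one factor moves to the other side. -/
theorem pow_exchange (hN : Γ.IsIncidenceMatrix N) {H : SimpleGraph V}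
    (hH : Γ.IsNonsingular H) {e f : Γ.graph.edgeSet} (he : (e : Sym2 V) ∈ H.edgeSet)
    (hf : (f : Sym2 V) ∉ H.edgeSet) {z z' : V → ℝ} (hz : Γ.IsDualRow N H e z)
    (hzf : (z ᵥ* N) f ≠ 0) (hz' : Γ.IsDualRow N (exchange H e f) f z') :
    (4 : ℝ) ^ Γ.numUnicyclic H * (z ᵥ* N) f
      = (4 : ℝ) ^ Γ.numUnicyclic (exchange H e f) * (z' ᵥ* N) e := by
  have hH' := hH.exchange_isNonsingular hN he hf hz hzf
  rw [hH.numUnicyclic_eq hN, hH'.numUnicyclic_eq hN]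
  obtain ⟨x, hx⟩ : ∃ x, z x ≠ 0 := by
    by_contra! h
    exact hzf (by rw [show z = 0 from funext h, Matrix.zero_vecMul]; rfl)
  have hsupp := fun u v => hH.reachable_of_isDualRow hN hz (u := u) (v := v)
  have h1 := hz.1.sq_vecMul_mul_pow hN hsupp hx (g := e) (by rw [hz.2]; exact one_ne_zero)
  have h2 := hz.1.sq_vecMul_mul_pow hN hsupp hx hzf
  rw [insertEdge_del he, hz.2, one_pow, one_mul] at h1
  have hz1 := hz'.1
  rw [del_exchange (not_isDiag_edge f) hf] at hz1
  have h3 := hH.isDualRow_unique hN hz1 hz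
  have h4 : (z' ᵥ* N) e * (z ᵥ* N) f = 1 := by
    have h5 := hz'.2
    rwa [h3, Matrix.smul_vecMul, Pi.smul_apply, smul_eq_mul] at h5
  change _ = 4 * z x ^ 2 * 4 ^ Nat.card (exchange H e f).ConnectedComponent at h2
  have h0 : (4 * z x ^ 2 : ℝ) ≠ 0 := mul_ne_zero four_ne_zero (pow_ne_zero 2 hx)
  apply mul_left_cancel₀ h0
  apply mul_right_cancel₀ hzf
  linear_combination h2 - (z ᵥ* N) f ^ 2 * h1
    - 4 * z x ^ 2 * 4 ^ Nat.card (exchange H e f).ConnectedComponent * h4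

end IsNonsingular

/-- The dual row if there is one, and zero otherwise. -/
noncomputable def dualRow (Γ : SignedGraph V) (N : Matrix V Γ.graph.edgeSet ℝ) (H : SimpleGraph V)
    (e : Γ.graph.edgeSet) : V → ℝ :=
  open Classical in
  if h : (e : Sym2 V) ∈ H.edgeSet ∧ ∃ z, Γ.IsDualRow N H e z then h.2.choose else 0

theorem IsNonsingular.isDualRow_dualRow (hN : Γ.IsIncidenceMatrix N) {H : SimpleGraph V}
    (hH : Γ.IsNonsingular H) (e : Γ.graph.edgeSet) (he : (e : Sym2 V) ∈ H.edgeSet) :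
    Γ.IsDualRow N H e (Γ.dualRow N H e) := by
  have h : (e : Sym2 V) ∈ H.edgeSet ∧ ∃ z, Γ.IsDualRow N H e z :=
    ⟨he, hH.exists_isDualRow hN e he⟩
  rw [dualRow, dif_pos h]
  exact h.2.choose_spec

theorem dualRow_of_notMem {H : SimpleGraph V} {e : Γ.graph.edgeSet}
    (he : (e : Sym2 V) ∉ H.edgeSet) : Γ.dualRow N H e = 0 := dif_neg fun h => he h.1

theorem vecMul_restrictCols (H : SimpleGraph V) (y : V → ℝ) {e : Γ.graph.edgeSet}
    (he : (e : Sym2 V) ∈ H.edgeSet) : (y ᵥ* Γ.restrictCols N H) e = (y ᵥ* N) e := by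
  simp [Matrix.vecMul, dotProduct, restrictCols, he]

theorem sum_spanningTUs_pos (hN : Γ.IsIncidenceMatrix N)
    (hker : ∀ y : V → ℝ, Γ.IsPotential Γ.graph y → y = 0) :
    0 < ∑ H ∈ Γ.spanningTUs, (4 : ℝ) ^ Γ.numUnicyclic H := by
  obtain ⟨H, hH⟩ := exists_isNonsingular hN hker
  exact Finset.sum_pos (fun _ _ => by positivity) ⟨H, (mem_spanningTUs_iff hN).2 hH⟩

variable [Fintype Γ.graph.edgeSet]

theorem IsNonsingular.restrictCols_mul_dualRow [DecidableEq V] (hN : Γ.IsIncidenceMatrix N)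
    {H : SimpleGraph V} (hH : Γ.IsNonsingular H) :
    Γ.restrictCols N H * Matrix.of (Γ.dualRow N H) = 1 ∧
    IsMoorePenroseInverse (Γ.restrictCols N H) (Matrix.of (Γ.dualRow N H)) := by
  refine isMoorePenroseInverse_of_dual {e | (e : Sym2 V) ∈ H.edgeSet} ?_ ?_ ?_ ?_ ?_
  · intro e he i
    exact if_neg he
  · exact fun e he => dualRow_of_notMem he
  · intro e he
    rw [vecMul_restrictCols H _ he]
    exact (hH.isDualRow_dualRow hN e he).2
  · intro e he f hf hfe
    rw [vecMul_restrictCols H _ hf]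
    exact vecMul_eq_zero_of_isPotential_del hN hH.1 (hH.isDualRow_dualRow hN e he).1 hf hfe
  · intro y hy
    apply hH.2.2
    rw [hN.isPotential_iff hH.1]
    intro e he
    rw [← vecMul_restrictCols H _ he]
    exact hy e he

theorem IsNonsingular.moorePenrose_restrictCols (hN : Γ.IsIncidenceMatrix N)
    {H : SimpleGraph V} (hH : Γ.IsNonsingular H) :
    moorePenrose (Γ.restrictCols N H) = Matrix.of (Γ.dualRow N H) := by
  classical
  exact (hH.restrictCols_mul_dualRow hN).2.moorePenrose_eq

theorem IsNonsingular.mul_dualRow [DecidableEq V] (hN : Γ.IsIncidenceMatrix N)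
    {H : SimpleGraph V} (hH : Γ.IsNonsingular H) : N * Matrix.of (Γ.dualRow N H) = 1 := by
  rw [← (hH.restrictCols_mul_dualRow hN).1]
  ext i j
  rw [Matrix.mul_apply, Matrix.mul_apply]
  refine Finset.sum_congr rfl fun e _ => ?_
  by_cases he : (e : Sym2 V) ∈ H.edgeSet
  · rw [restrictCols, if_pos he]
  · rw [Matrix.of_apply, dualRow_of_notMem he, Pi.zero_apply, mul_zero, mul_zero]

/-- The Moore–Penrose inverse of the incidence matrix of an unbalanced signed graph is an average
over the spanning `TU`-subgraphs. -/
theorem moorePenrose_unbalanced (hN : Γ.IsIncidenceMatrix N)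
    (hker : ∀ y : V → ℝ, Γ.IsPotential Γ.graph y → y = 0) :
    moorePenrose N =
      averagedInverse Γ.spanningTUs (fun H => (4 : ℝ) ^ Γ.numUnicyclic H) (Γ.dualRow N) := by
  classical
  apply IsMoorePenroseInverse.moorePenrose_eq
  apply isMoorePenroseInverse_averagedInverse _ _ _ (sum_spanningTUs_pos hN hker).ne'
    Matrix.transpose_one (Matrix.one_mul _)
  · intro H _ e
    rw [Matrix.vecMul_one]
  · intro H hH
    exact ((mem_spanningTUs_iff hN).1 hH).mul_dualRow hN
  · apply sum_dual_symm
    · exact fun H _ e he => dualRow_of_notMem he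
    · intro H hH e f he hf hfe
      have hH := (mem_spanningTUs_iff hN).1 hH
      exact vecMul_eq_zero_of_isPotential_del hN hH.1 (hH.isDualRow_dualRow hN e he).1 hf hfe
    · intro H hH e f he hf h0
      have hH := (mem_spanningTUs_iff hN).1 hH
      have hz := hH.isDualRow_dualRow hN e he
      have hH' := hH.exchange_isNonsingular hN he hf hz h0
      exact ⟨(mem_spanningTUs_iff hN).2 hH', hH.pow_exchange hN he hf hz h0
        (hH'.isDualRow_dualRow hN f (mem_exchange (not_isDiag_edge f)))⟩

theorem moorePenrose_unbalanced_apply (hN : Γ.IsIncidenceMatrix N)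
    (hker : ∀ y : V → ℝ, Γ.IsPotential Γ.graph y → y = 0) (e : Γ.graph.edgeSet) (i : V) :
    moorePenrose N e i = (∑ H ∈ Γ.spanningTUs, (4 : ℝ) ^ Γ.numUnicyclic H)⁻¹ *
      ∑ H ∈ Γ.spanningTUsWith e,
        (4 : ℝ) ^ Γ.numUnicyclic H * moorePenrose (Γ.restrictCols N H) e i := by
  rw [moorePenrose_unbalanced hN hker, averagedInverse, Matrix.of_apply, spanningTUsWith,
    Finset.sum_filter]
  congr 1
  refine Finset.sum_congr rfl fun H hH => ?_
  split_ifs with he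
  · rw [((mem_spanningTUs_iff hN).1 hH).moorePenrose_restrictCols hN, Matrix.of_apply]
  · rw [dualRow_of_notMem he, Pi.zero_apply, mul_zero]

/-- If `N` has trivial left kernel, then `N Nᵀ` is invertible. -/
theorem isUnit_mul_transpose [DecidableEq V] (hN : Γ.IsIncidenceMatrix N)
    (hker : ∀ y : V → ℝ, Γ.IsPotential Γ.graph y → y = 0) : IsUnit (N * Nᵀ) := by
  rw [← Matrix.vecMul_injective_iff_isUnit]
  intro y y' h
  rw [← sub_eq_zero]
  apply hker
  rw [hN.isPotential_iff le_rfl]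
  intro e _
  have h1 : (y - y') ᵥ* (N * Nᵀ) = 0 := by
    rw [Matrix.sub_vecMul, sub_eq_zero]
    exact h
  have h2 : ((y - y') ᵥ* N) ⬝ᵥ ((y - y') ᵥ* N) = 0 := by
    rw [← Matrix.vecMul_vecMul, Matrix.vecMul_transpose] at h1
    nth_rewrite 2 [← Matrix.mulVec_transpose]
    rw [Matrix.dotProduct_mulVec, Matrix.vecMul_transpose, h1, zero_dotProduct]
  rw [dotProduct_self_eq_zero] at h2
  exact congrFun h2 e

theorem isMoorePenroseInverse_inv {n : Type*} [Fintype n] [DecidableEq n] {A : Matrix n n ℝ}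
    (hA : IsUnit A) : IsMoorePenroseInverse A A⁻¹ := by
  have hdet := (Matrix.isUnit_iff_isUnit_det A).1 hA
  refine ⟨?_, ?_, ?_, ?_⟩ <;> simp [Matrix.mul_nonsing_inv _ hdet, Matrix.nonsing_inv_mul _ hdet]

end SignedGraph

/-! ### Heads, tails, and the combinatorial entries of the unbalanced case. -/

namespace SignedGraph

open SimpleGraph Matrix

variable {V : Type*} [LinearOrder V] {Γ : SignedGraph V} {N : Matrix V Γ.graph.edgeSet ℝ}

theorem coe_eq_tail_head (e : Γ.graph.edgeSet) :
    (e : Sym2 V) = s(Γ.tail N e, Γ.head N e) := by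
  have h : (e : Sym2 V) = s((e : Sym2 V).inf, (e : Sym2 V).sup) := by
    generalize (e : Sym2 V) = x
    induction x using Sym2.ind with | _ a b =>
    rw [Sym2.inf_mk, Sym2.sup_mk]
    rcases le_total a b with hab | hab
    · rw [inf_eq_left.2 hab, sup_eq_right.2 hab]
    · rw [inf_eq_right.2 hab, sup_eq_left.2 hab, Sym2.eq_swap]
  rw [tail, head]
  split_ifs
  · rw [Sym2.eq_swap]; exact h
  · exact h

theorem tail_mem (e : Γ.graph.edgeSet) : Γ.tail N e ∈ (e : Sym2 V) := by
  rw [coe_eq_tail_head (N := N) e]; exact Sym2.mem_mk_left _ _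

theorem head_mem (e : Γ.graph.edgeSet) : Γ.head N e ∈ (e : Sym2 V) := by
  rw [coe_eq_tail_head (N := N) e]; exact Sym2.mem_mk_right _ _

namespace IsIncidenceMatrix

theorem tail_mul_head (hN : Γ.IsIncidenceMatrix N) (e : Γ.graph.edgeSet) :
    N (Γ.tail N e) e * N (Γ.head N e) e = -((Γ.sign e : ℤ) : ℝ) := by
  rw [hN.entry_mul_entry (coe_eq_tail_head e), ← coe_eq_tail_head, realSign_coe]

/-- A positive edge has entry 1 at its tail by the choice of direction; a negative edge has equal
entries at its ends, and `w(e)` is their common value. -/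
theorem entry_tail (hN : Γ.IsIncidenceMatrix N) (e : Γ.graph.edgeSet) :
    N (Γ.tail N e) e = Γ.endWeight N e := by
  have hmul := hN.tail_mul_head e
  have ht := (hN e).2.1 _ (tail_mem (N := N) e)
  rcases Int.units_eq_one_or (Γ.sign e) with h | h
  · have h1 : ¬ ((1 : ℤˣ) = -1) := by decide
    rw [endWeight, if_neg (by simp [h, h1])]
    rw [h] at hmul
    by_cases hinf : N (e : Sym2 V).inf e = -1
    · have hhead : Γ.head N e = (e : Sym2 V).inf := if_pos ⟨h, hinf⟩
      rw [hhead, hinf] at hmul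
      push_cast at hmul
      linarith
    · have htail : Γ.tail N e = (e : Sym2 V).inf := if_neg fun h => hinf h.2
      rw [htail] at ht ⊢
      exact ht.resolve_right hinf
  · rw [h] at hmul
    push_cast at hmul
    rw [endWeight]
    rcases ht with ht | ht
    · rw [if_neg, ht]
      rintro ⟨-, h2⟩
      have := h2 _ (tail_mem (N := N) e)
      rw [ht] at this
      norm_num at this
    · rw [if_pos, ht]
      refine ⟨h, fun i hi => ?_⟩
      rw [coe_eq_tail_head (N := N) e, Sym2.mem_iff] at hi
      rw [ht] at hmul
      rcases hi with rfl | rfl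
      · exact ht
      · linarith

theorem entry_head (hN : Γ.IsIncidenceMatrix N) (e : Γ.graph.edgeSet) :
    N (Γ.head N e) e = -((Γ.sign e : ℤ) : ℝ) * Γ.endWeight N e := by
  rw [← hN.tail_mul_head, ← hN.entry_tail]
  linear_combination -N (Γ.head N e) e * hN.entry_mul_self (tail_mem (N := N) e)

end IsIncidenceMatrix

variable [Fintype V]

/-- The row is supported on one component of `H ∖ e`. If `e` is on the cycle, its ends share the
normalization equally, whence the `1/2`. Otherwise `z` vanishes on the side of the cycle, and the
end `u` on the other side has `z u = N u e`. Transport from that end gives the path sign, and the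
entry `-σ(e) w(e)` at the head gives the minus sign of positive edges. -/
theorem IsNonsingular.dualRow_eq_tuEntry (hN : Γ.IsIncidenceMatrix N) {H : SimpleGraph V}
    (hH : Γ.IsNonsingular H) {e : Γ.graph.edgeSet} (he : (e : Sym2 V) ∈ H.edgeSet) {z : V → ℝ}
    (hz : Γ.IsDualRow N H e z) (j : V) : z j = Γ.endWeight N e * Γ.tuEntry N H e j := by
  classical
  have hth : (e : Sym2 V) = s(Γ.tail N e, Γ.head N e) := coe_eq_tail_head e
  have hNt := hN.entry_tail e
  have hNh := hN.entry_head e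
  have hNtt := hN.entry_mul_self (tail_mem (N := N) e)
  have hNhh := hN.entry_mul_self (head_mem (N := N) e)
  have hze := hz.2
  rw [hN.vecMul_apply z hth] at hze
  have hhc : j ∈ Γ.headComp N H e ↔ (del H e).Reachable (Γ.head N e) j := Iff.rfl
  simp only [tuEntry]
  generalize Γ.tail N e = t at *
  generalize Γ.head N e = h at *
  have hadj : H.Adj t h := by rwa [hth] at he
  have hle := del_le H e
  have hcycle : (del H e).Reachable t h ↔
      ∃ C ∈ cyclesIn H (H.connectedComponentMk t), (e : Sym2 V) ∈ C := by
    rw [hth]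
    constructor
    · intro hr
      obtain ⟨v, p, hp, hep⟩ := adj_and_reachable_delete_edges_iff_exists_cycle.1 ⟨hadj, hr⟩
      exact ⟨_, ⟨v, p, ConnectedComponent.sound
        ⟨p.takeUntil t (p.fst_mem_support_of_mem_edges hep)⟩, hp, rfl⟩, hep⟩
    · rintro ⟨_, ⟨v, p, -, hp, rfl⟩, hep⟩
      exact (adj_and_reachable_delete_edges_iff_exists_cycle.2 ⟨v, p, hp, hep⟩).2
  split_ifs with h1 h2 h3 h4
  -- The negated condition `j ∉ U.supp` is split as a membership, so its zero branch comes last.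
  rotate_right 1
  · rw [mul_zero]
    by_contra hj
    apply h1
    apply ConnectedComponent.sound
    by_cases ht : z t = 0
    · have hh : z h ≠ 0 := fun hh => by rw [ht, hh] at hze; simp at hze
      exact ((hH.reachable_of_isDualRow hN hz hj hh).mono hle).trans hadj.symm.reachable
    · exact (hH.reachable_of_isDualRow hN hz hj ht).mono hle
  · have hr := hcycle.2 h2
    have hj : (del H e).Reachable t j := by
      rw [hth] at hr ⊢
      exact reachable_del_of_reachable hadj hr
        (ConnectedComponent.exact h1).symm
    obtain ⟨u, rfl, -, hu⟩ := hz.1.exists_eq_pathSign_mul {t} j ⟨t, rfl, hj⟩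
    have hsq := hz.1.mul_self_eq hr
    have hzu : z u = 1 / 2 * N u e := by
      -- The two contributions have equal squares and sum 1, so they are equal.
      have h5 : z u * N u e - z h * N h e = 0 := by
        linear_combination z u * z u * hNtt - z h * z h * hNhh - hsq
          - (z u * N u e - z h * N h e) * hze
      linear_combination (1 / 2 * N u e) * (hze + h5) - z u * hNtt
    rw [hu, hzu, hNt]
    ring
  · rw [mul_zero]
    obtain ⟨C, hC, f, hf, v, hv, hvj⟩ := h3
    have heC : (e : Sym2 V) ∉ C := fun h => h2 ⟨C, hC, h⟩
    obtain ⟨w, p, hw, hp, rfl⟩ := hC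
    have hvp : v ∈ (p.transfer (del H e) (mem_edgeSet_del_of_notMem p heC)).support := by
      rw [Walk.support_transfer]
      obtain ⟨v', rfl⟩ := hv
      exact p.fst_mem_support_of_mem_edges hf
    refine hz.1.eq_zero_of_walkSign (hvj.symm.trans ⟨(Walk.takeUntil _ v hvp).reverse⟩)
      (p.transfer (del H e) (mem_edgeSet_del_of_notMem p heC)) ?_
    rw [walkSign_transfer]
    exact hH.walkSign_cycle_ne_one hN p hp
  all_goals
    have hbr : ¬ (del H e).Reachable t h := fun h => h2 (hcycle.1 h)
    have hcases : ∀ {x}, H.Reachable t x → (del H e).Reachable t x ∨ (del H e).Reachable h x := by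
      rw [hth]
      exact fun hx => reachable_del_or hadj hx
    have hex : ∃ u ∈ {u | u ∈ (e : Sym2 V)}, (del H e).Reachable u j := by
      rcases hcases (ConnectedComponent.exact h1).symm with h | h
      · exact ⟨_, by simp [hth], h⟩
      · exact ⟨_, by simp [hth], h⟩
    obtain ⟨u, hu, huj, hzu⟩ := hz.1.exists_eq_pathSign_mul _ j hex
    -- Stated for both orders of the ends. If `z u = 0`, then `z u' ≠ 0`, so the unbalanced cycle is
    -- not on the side of `u'`. It is then on the side of `u` and `j`, which `h3` excludes.
    have key : ∀ u u', z u * N u e + z u' * N u' e = 1 → N u e * N u e = 1 →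
        ¬ (del H e).Reachable u u' →
        (∀ x, H.Reachable t x → (del H e).Reachable u x ∨ (del H e).Reachable u' x) →
        (del H e).Reachable u j → z u = N u e := by
      intro u u' hsum huu hnr hor huj
      by_cases hu0 : z u = 0
      · exfalso
        have hu0' : z u' ≠ 0 := fun h => by rw [hu0, h] at hsum; simp at hsum
        obtain ⟨C, hC, -⟩ := hH.isUnbalancedUnicyclicComponent hN (H.connectedComponentMk t)
        have hCm : C ∈ cyclesIn H (H.connectedComponentMk t) := hC ▸ rfl
        have heC : (e : Sym2 V) ∉ C := fun h => h2 ⟨C, hCm, h⟩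
        obtain ⟨w, p, hw, hp, rfl⟩ := id hCm
        rcases hor w (ConnectedComponent.exact hw).symm with hr | hr
        · apply h3
          obtain ⟨f, hf, hwf⟩ : ∃ f ∈ p.edges, w ∈ f := by
            cases p with
            | nil => exact absurd rfl hp.ne_nil
            | cons h p => exact ⟨_, by rw [Walk.edges_cons]; exact List.mem_cons_self,
                Sym2.mem_mk_left _ _⟩
          exact ⟨_, hCm, f, hf, w, hwf, hr.symm.trans huj⟩
        · refine hu0' (hz.1.eq_zero_of_walkSign hr
            (p.transfer (del H e) (mem_edgeSet_del_of_notMem p heC)) ?_)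
          rw [walkSign_transfer]
          exact hH.walkSign_cycle_ne_one hN p hp
      · have hu0' : z u' = 0 := by
          by_contra h
          exact hnr (hH.reachable_of_isDualRow hN hz hu0 h)
        rw [hu0'] at hsum
        linear_combination N u e * hsum - z u * huu
    rw [edgePathSign, hzu]
    have hu' : u = t ∨ u = h := by
      have : u ∈ (e : Sym2 V) := hu
      rwa [hth, Sym2.mem_iff] at this
  · obtain rfl : u = h := hu'.resolve_left fun h => hbr (h ▸ huj.trans (hhc.1 h4.2).symm)
    rw [key u t (by linarith) hNhh (fun h => hbr h.symm) (fun x hx => (hcases hx).symm) huj, hNh,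
      h4.1]
    push_cast
    ring
  · rcases hu' with rfl | rfl
    · rw [key u h hze hNtt hbr (fun x hx => hcases hx) huj, hNt]
      ring
    · rw [key u t (by linarith) hNhh (fun h => hbr h.symm) (fun x hx => (hcases hx).symm) huj, hNh]
      rcases Int.units_eq_one_or (Γ.sign e) with h5 | h5
      · exact absurd ⟨h5, hhc.2 huj⟩ h4
      · rw [h5]
        push_cast
        ring

end SignedGraph

/-! ### The balanced case: switching functions and spanning trees. -/

namespace SignedGraph

open SimpleGraph Matrix

section Switching

variable {V : Type*} {Γ : SignedGraph V} {N : Matrix V Γ.graph.edgeSet ℝ}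

/-- Balance makes the signs of the walks from a root well defined, and connectedness makes them
nonzero everywhere. -/
theorem Balanced.exists_switching (hΓ : Γ.Balanced) (hconn : Γ.graph.Connected) :
    ∃ s : V → ℝ, Γ.IsPotential Γ.graph s ∧ ∀ v, s v * s v = 1 := by
  obtain ⟨r⟩ := hconn.nonempty
  have hF : ∀ (w : V) (c : Γ.graph.Walk w w), Γ.graph.Reachable r w → c.IsCycle →
      Γ.walkSign c = 1 := fun w c _ hc =>
    (isBalancedCycle_iff_walkSign Γ hc).1 (hΓ _ ⟨w, c, hc, rfl⟩)
  refine ⟨_, Γ.isPotential_componentPotential hF, fun v => ?_⟩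
  rw [(Γ.isPotential_componentPotential hF).mul_self_eq (hconn.preconnected r v),
    Γ.componentPotential_self hF, one_mul]

/-- The product `y v * s v` is constant on a connected `T`. This replaces the trivial left kernel of
the unbalanced case: potentials on `T` are the multiples of `s`. -/
theorem eq_zero_of_isPotential_of_dotProduct [Fintype V] {T : SimpleGraph V} (hT : T.Connected)
    {s y : V → ℝ} (hs : Γ.IsPotential T s) (hss : ∀ v, s v * s v = 1) (hy : Γ.IsPotential T y)
    (h0 : y ⬝ᵥ s = 0) : y = 0 := by
  obtain ⟨r⟩ := hT.nonempty
  have h1 : ∀ v, y v * s v = y r * s r := by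
    intro v
    obtain ⟨p⟩ := hT.preconnected r v
    rw [hs.transport p, hy.transport p, mul_mul_mul_comm, units_cast_mul_self, one_mul]
  have hr : y r = 0 := by
    rw [dotProduct, Finset.sum_congr rfl fun v _ => h1 v, Finset.sum_const, nsmul_eq_mul] at h0
    rcases mul_eq_zero.1 h0 with h | h
    · have : Nonempty V := ⟨r⟩
      simp at h
    · linear_combination s r * h - y r * hss r
  funext v
  exact hy.eq_zero_of_reachable (hT.preconnected r v) hr

theorem mem_spanningTrees_iff [Fintype V] {T : SimpleGraph V} :
    T ∈ Γ.spanningTrees ↔ T ≤ Γ.graph ∧ T.IsTree := by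
  rw [spanningTrees, Set.Finite.mem_toFinset]
  rfl

theorem spanningTrees_nonempty [Fintype V] (hconn : Γ.graph.Connected) : Γ.spanningTrees.Nonempty := by
  obtain ⟨T, hle, hT⟩ := hconn.exists_isTree_le
  exact ⟨T, mem_spanningTrees_iff.2 ⟨hle, hT⟩⟩

end Switching

variable {V : Type*} [LinearOrder V] {Γ : SignedGraph V} {N : Matrix V Γ.graph.edgeSet ℝ}

section Tree

variable {T : SimpleGraph V} {e : Γ.graph.edgeSet}

theorem not_reachable_tail_head (hT : T.IsTree) (he : (e : Sym2 V) ∈ T.edgeSet) :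
    ¬ (del T e).Reachable (Γ.tail N e) (Γ.head N e) := by
  have hth := coe_eq_tail_head (N := N) e
  rw [hth] at he ⊢
  exact isBridge_iff.1 (isAcyclic_iff_forall_adj_isBridge.1 hT.isAcyclic he)

theorem headComp_eq_compl (hT : T.IsTree) (he : (e : Sym2 V) ∈ T.edgeSet) :
    Γ.headComp N T e = (Γ.tailComp N T e)ᶜ := by
  have hnr := not_reachable_tail_head (N := N) hT he
  have hth := coe_eq_tail_head (N := N) e
  ext x
  refine ⟨fun hx hx' => hnr (Reachable.trans hx' (Reachable.symm hx)), fun hx => ?_⟩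
  have hadj : T.Adj (Γ.tail N e) (Γ.head N e) := by rwa [hth] at he
  have := reachable_del_or hadj (hT.connected.preconnected _ x)
  rw [← hth] at this
  exact this.resolve_left hx

theorem mem_tailComp_iff_of_reachable {a b : V} (hab : (del T e).Reachable a b) :
    a ∈ Γ.tailComp N T e ↔ b ∈ Γ.tailComp N T e :=
  ⟨fun h => Reachable.trans h hab, fun h => Reachable.trans h hab.symm⟩

theorem tail_mem_tailComp : Γ.tail N e ∈ Γ.tailComp N T e := Reachable.refl _

theorem head_notMem_tailComp (hT : T.IsTree) (he : (e : Sym2 V) ∈ T.edgeSet) :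
    Γ.head N e ∉ Γ.tailComp N T e := not_reachable_tail_head hT he

theorem ncard_tailComp_add_ncard_headComp [Fintype V] (hT : T.IsTree)
    (he : (e : Sym2 V) ∈ T.edgeSet) :
    ((Γ.tailComp N T e).ncard : ℝ) + (Γ.headComp N T e).ncard = Fintype.card V := by
  rw [headComp_eq_compl hT he, ← Nat.cast_add, Set.ncard_add_ncard_compl,
    Nat.card_eq_fintype_card]

end Tree

/-- The size of the other component of `T ∖ e`, negative on the component of the head. -/
noncomputable def sideSize (Γ : SignedGraph V) (N : Matrix V Γ.graph.edgeSet ℝ) (T : SimpleGraph V)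
    (e : Γ.graph.edgeSet) (i : V) : ℝ :=
  open Classical in
  if i ∈ Γ.tailComp N T e then (Γ.headComp N T e).ncard else -((Γ.tailComp N T e).ncard : ℝ)

/-- Row `e` of the Moore–Penrose inverse of the incidence matrix of the spanning tree `T`, in
terms of a switching function `s`. -/
noncomputable def treeRow [Fintype V] (Γ : SignedGraph V) (N : Matrix V Γ.graph.edgeSet ℝ)
    (s : V → ℝ) (T : SimpleGraph V) (e : Γ.graph.edgeSet) : V → ℝ :=
  open Classical in
  fun i => if (e : Sym2 V) ∈ T.edgeSet then
    N (Γ.tail N e) e / Fintype.card V * (s (Γ.tail N e) * s i) * Γ.sideSize N T e i else 0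

/-- The contribution of the spanning tree `T` to the entry `(e, i)`. -/
noncomputable def treeTerm (Γ : SignedGraph V) (N : Matrix V Γ.graph.edgeSet ℝ) (T : SimpleGraph V)
    (e : Γ.graph.edgeSet) (i : V) : ℝ :=
  open Classical in
  Γ.edgePathSign T e i * if i ∈ Γ.tailComp N T e then ((Γ.headComp N T e).ncard : ℝ)
    else -((Γ.sign e : ℤ) : ℝ) * (Γ.tailComp N T e).ncard

theorem sideSize_congr {T : SimpleGraph V} {e : Γ.graph.edgeSet} {a b : V}
    (h : a ∈ Γ.tailComp N T e ↔ b ∈ Γ.tailComp N T e) :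
    Γ.sideSize N T e a = Γ.sideSize N T e b := by
  rw [sideSize, sideSize]
  by_cases hb : b ∈ Γ.tailComp N T e
  · rw [if_pos hb, if_pos (h.2 hb)]
  · rw [if_neg hb, if_neg (mt h.1 hb)]

/-- `Ψ` splits into one factor per tree; the case of two head sides uses `σ(e) ^ 2 = 1`. -/
theorem treeTerm_mul_treeTerm {T T' : SimpleGraph V} (hT : T.IsTree) (hT' : T'.IsTree)
    {e : Γ.graph.edgeSet} (he : (e : Sym2 V) ∈ T.edgeSet) (he' : (e : Sym2 V) ∈ T'.edgeSet)
    (i j : V) : Γ.treeTerm N T e i * Γ.treeTerm N T' e j =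
      Γ.edgePathSign T e i * Γ.edgePathSign T' e j * Γ.sizeFactor N T T' e i j := by
  have hσ := units_cast_mul_self (Γ.sign e)
  have hi : i ∈ Γ.headComp N T e ↔ i ∉ Γ.tailComp N T e := by rw [headComp_eq_compl hT he]; rfl
  have hj : j ∈ Γ.headComp N T' e ↔ j ∉ Γ.tailComp N T' e := by rw [headComp_eq_compl hT' he']; rfl
  rw [treeTerm, treeTerm, sizeFactor]
  by_cases h1 : i ∈ Γ.tailComp N T e <;> by_cases h2 : j ∈ Γ.tailComp N T' e
  · rw [if_pos h1, if_pos h2, if_pos ⟨h1, h2⟩]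
    ring
  · rw [if_pos h1, if_neg h2, if_neg (by tauto), if_neg (by tauto), if_pos (by tauto)]
    ring
  · rw [if_neg h1, if_pos h2, if_neg (by tauto), if_neg (by tauto), if_neg (by tauto)]
    ring
  · rw [if_neg h1, if_neg h2, if_neg (by tauto), if_pos (by tauto)]
    linear_combination Γ.edgePathSign T e i * Γ.edgePathSign T' e j *
      (Γ.tailComp N T e).ncard * (Γ.tailComp N T' e).ncard * hσ

variable [Fintype V]

theorem treeRow_of_notMem {s : V → ℝ} {T : SimpleGraph V} {e : Γ.graph.edgeSet}
    (he : (e : Sym2 V) ∉ T.edgeSet) : Γ.treeRow N s T e = 0 :=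
  funext fun _ => if_neg he

theorem treeRow_apply {s : V → ℝ} {T : SimpleGraph V} {e : Γ.graph.edgeSet}
    (he : (e : Sym2 V) ∈ T.edgeSet) (i : V) : Γ.treeRow N s T e i =
      N (Γ.tail N e) e / Fintype.card V * (s (Γ.tail N e) * s i) * Γ.sideSize N T e i :=
  if_pos he

/-- The sum over vertices is `|T_t| |T_h| - |T_h| |T_t|`. Orthogonality to `s` selects this row
among the potentials on `T ∖ e` normalized at `e`. -/
theorem treeRow_dotProduct {s : V → ℝ} (hss : ∀ v, s v * s v = 1) {T : SimpleGraph V}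
    (hT : T.IsTree) (e : Γ.graph.edgeSet) : Γ.treeRow N s T e ⬝ᵥ s = 0 := by
  classical
  by_cases he : (e : Sym2 V) ∈ T.edgeSet
  · have h1 : ∀ i, Γ.treeRow N s T e i * s i =
        N (Γ.tail N e) e / Fintype.card V * s (Γ.tail N e) * Γ.sideSize N T e i := by
      intro i
      rw [treeRow_apply he]
      linear_combination
        N (Γ.tail N e) e / Fintype.card V * s (Γ.tail N e) * Γ.sideSize N T e i * hss i
    have h2 : ∑ i, Γ.sideSize N T e i = 0 := by
      have hA : ((Finset.univ.filter (· ∈ Γ.tailComp N T e)).card : ℝ)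
          = (Γ.tailComp N T e).ncard := by
        rw [← Set.ncard_coe_finset]
        congr 2
        ext; simp
      have hB : ((Finset.univ.filter (· ∉ Γ.tailComp N T e)).card : ℝ)
          = (Γ.headComp N T e).ncard := by
        rw [headComp_eq_compl hT he, ← Set.ncard_coe_finset]
        congr 2
        ext; simp
      simp only [sideSize]
      rw [Finset.sum_ite, Finset.sum_const, Finset.sum_const, nsmul_eq_mul, nsmul_eq_mul, hA, hB]
      ring
    rw [dotProduct, Finset.sum_congr rfl fun i _ => h1 i, ← Finset.mul_sum, h2, mul_zero]
  · rw [treeRow_of_notMem he, zero_dotProduct]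

theorem isPotential_treeRow {s : V → ℝ} {T : SimpleGraph V} (hs : Γ.IsPotential T s)
    {e : Γ.graph.edgeSet} (he : (e : Sym2 V) ∈ T.edgeSet) :
    Γ.IsPotential (del T e) (Γ.treeRow N s T e) := by
  intro a b hab
  have hside : Γ.sideSize N T e b = Γ.sideSize N T e a :=
    sideSize_congr (mem_tailComp_iff_of_reachable hab.symm.reachable)
  rw [treeRow_apply he, treeRow_apply he, hside, hs a b (del_le T e hab)]
  ring

/-- The value of a tree row on a column, by the sides of the ends of the edge. -/
theorem treeRow_vecMul (hN : Γ.IsIncidenceMatrix N) {s : V → ℝ} (hs : Γ.IsPotential Γ.graph s)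
    {T : SimpleGraph V} {e : Γ.graph.edgeSet} (he : (e : Sym2 V) ∈ T.edgeSet)
    {f : Γ.graph.edgeSet} {a b : V} (hf : (f : Sym2 V) = s(a, b)) :
    (Γ.treeRow N s T e ᵥ* N) f = N (Γ.tail N e) e / Fintype.card V * s (Γ.tail N e) *
      (s a * N a f) * (Γ.sideSize N T e a - Γ.sideSize N T e b) := by
  -- As `s` is orthogonal to column `f`, the products `s a * N a f` and `s b * N b f` are opposite.
  have h0 := (hN.isPotential_iff le_rfl s).1 hs f f.2
  rw [hN.vecMul_apply s hf] at h0
  rw [hN.vecMul_apply _ hf, treeRow_apply he, treeRow_apply he]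
  linear_combination
    N (Γ.tail N e) e / Fintype.card V * s (Γ.tail N e) * Γ.sideSize N T e b * h0

/-- Across `e` the side size jumps by `|T_h| + |T_t| = n`, which the factor `1 / n` normalizes. -/
theorem isDualRow_treeRow (hN : Γ.IsIncidenceMatrix N) {s : V → ℝ}
    (hs : Γ.IsPotential Γ.graph s) (hss : ∀ v, s v * s v = 1) {T : SimpleGraph V}
    (hle : T ≤ Γ.graph) (hT : T.IsTree) {e : Γ.graph.edgeSet} (he : (e : Sym2 V) ∈ T.edgeSet) :
    Γ.IsDualRow N T e (Γ.treeRow N s T e) := by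
  refine ⟨isPotential_treeRow (hs.mono hle) he, ?_⟩
  have hn : (Fintype.card V : ℝ) ≠ 0 := by
    have := hT.connected.nonempty
    exact Nat.cast_ne_zero.2 Fintype.card_ne_zero
  rw [treeRow_vecMul hN hs he (coe_eq_tail_head e), sideSize, sideSize,
    if_pos tail_mem_tailComp, if_neg (head_notMem_tailComp hT he), sub_neg_eq_add, add_comm,
    ncard_tailComp_add_ncard_headComp hT he]
  have h1 := hN.entry_mul_self (tail_mem (N := N) e)
  have h2 := hss (Γ.tail N e)
  field_simp
  linear_combination s (Γ.tail N e) ^ 2 * h1 + h2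

/-- Different side sizes put the ends of `f` on different sides of `T ∖ e`; the exchanged graph is
then connected and has as many edges as `T`. -/
theorem exchange_isTree {T : SimpleGraph V} (hT : T.IsTree) {e f : Γ.graph.edgeSet}
    (he : (e : Sym2 V) ∈ T.edgeSet) (hf : (f : Sym2 V) ∉ T.edgeSet) {a b : V}
    (hfab : (f : Sym2 V) = s(a, b))
    (hab : Γ.sideSize N T e a ≠ Γ.sideSize N T e b) : (exchange T e f).IsTree := by
  have hd := not_isDiag_edge f
  have hle : del T e ≤ exchange T e f := le_insertEdge _ hd
  have hadj : (exchange T e f).Adj a b := (insertEdge_adj hd).2 (Or.inl hfab.symm)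
  have hcompl := headComp_eq_compl (N := N) hT he
  have hab' : ¬ (a ∈ Γ.tailComp N T e ↔ b ∈ Γ.tailComp N T e) := fun h => hab (sideSize_congr h)
  have hor : ∀ x, (del T e).Reachable (Γ.tail N e) x ∨ (del T e).Reachable (Γ.head N e) x := by
    intro x
    by_cases hx : x ∈ Γ.tailComp N T e
    · exact Or.inl hx
    · rw [← Set.mem_compl_iff, ← hcompl] at hx
      exact Or.inr hx
  have hth : (exchange T e f).Reachable (Γ.tail N e) (Γ.head N e) := by
    rcases hor a with ha | ha <;> rcases hor b with hb | hb
    · exact absurd ⟨fun _ => hb, fun _ => ha⟩ hab'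
    · exact (ha.mono hle).trans (hadj.reachable.trans (hb.symm.mono hle))
    · exact (hb.mono hle).trans (hadj.symm.reachable.trans (ha.symm.mono hle))
    · refine absurd ?_ hab'
      exact mem_tailComp_iff_of_reachable (ha.symm.trans hb)
  rw [isTree_iff_connected_and_card] at hT ⊢
  have hreach : ∀ x, (exchange T e f).Reachable (Γ.tail N e) x := fun x =>
    (hor x).elim (fun h => h.mono hle) fun h => hth.trans (h.mono hle)
  have := hT.1.nonempty
  refine ⟨⟨fun x y => (hreach x).symm.trans (hreach y)⟩, ?_⟩
  rw [Nat.card_coe_set_eq, ncard_edgeSet_exchange hd he hf, ← Nat.card_coe_set_eq, hT.2]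

/-- The side sizes at the ends of `f` differ by `±n`, so the entry squares to 1. The two entries are
reciprocal, hence equal, and all trees have the same weight. -/
theorem treeRow_exchange (hN : Γ.IsIncidenceMatrix N) {s : V → ℝ}
    (hs : Γ.IsPotential Γ.graph s) (hss : ∀ v, s v * s v = 1) {T : SimpleGraph V}
    (hle : T ≤ Γ.graph) (hT : T.IsTree) {e f : Γ.graph.edgeSet} (he : (e : Sym2 V) ∈ T.edgeSet)
    (hf : (f : Sym2 V) ∉ T.edgeSet) (h0 : (Γ.treeRow N s T e ᵥ* N) f ≠ 0) :
    exchange T e f ∈ Γ.spanningTrees ∧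
      (Γ.treeRow N s T e ᵥ* N) f = (Γ.treeRow N s (exchange T e f) f ᵥ* N) e := by
  obtain ⟨a, b, hfab⟩ : ∃ a b, (f : Sym2 V) = s(a, b) := ⟨_, _, coe_eq_tail_head (N := N) f⟩
  have hn : (Fintype.card V : ℝ) ≠ 0 := by
    have := hT.connected.nonempty
    exact Nat.cast_ne_zero.2 Fintype.card_ne_zero
  have hval := treeRow_vecMul hN hs he hfab
  have hne : Γ.sideSize N T e a ≠ Γ.sideSize N T e b := by
    intro h
    rw [hval, h, sub_self, mul_zero] at h0
    exact h0 rfl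
  have hT' := exchange_isTree hT he hf hfab hne
  have hle' : exchange T e f ≤ Γ.graph := insertEdge_le ((del_le T e).trans hle) f
  refine ⟨mem_spanningTrees_iff.2 ⟨hle', hT'⟩, ?_⟩
  have hsq : (Γ.treeRow N s T e ᵥ* N) f * (Γ.treeRow N s T e ᵥ* N) f = 1 := by
    have hside : (Γ.sideSize N T e a - Γ.sideSize N T e b) ^ 2 = (Fintype.card V : ℝ) ^ 2 := by
      rw [← ncard_tailComp_add_ncard_headComp (N := N) hT he]
      simp only [sideSize] at hne ⊢
      split_ifs at hne ⊢
      · exact absurd rfl hne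
      · ring
      · ring
      · exact absurd rfl hne
    have h1 := hN.entry_mul_self (tail_mem (N := N) e)
    have h2 := hss (Γ.tail N e)
    have h3 := hN.entry_mul_self (e := f) (i := a) (by rw [hfab]; exact Sym2.mem_mk_left a b)
    have h4 := hss a
    rw [hval]
    calc _ = (N (Γ.tail N e) e * N (Γ.tail N e) e) * (s (Γ.tail N e) * s (Γ.tail N e)) *
          (s a * s a) * (N a f * N a f) * (Γ.sideSize N T e a - Γ.sideSize N T e b) ^ 2 /
          (Fintype.card V : ℝ) ^ 2 := by ring
      _ = 1 := by
        rw [h1, h2, h3, h4, hside]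
        field_simp
  have hz := isDualRow_treeRow hN hs hss hle hT he
  have hz' := isDualRow_treeRow hN hs hss hle' hT' (mem_exchange (not_isDiag_edge f))
  set z := Γ.treeRow N s T e with hzdef
  set z' := Γ.treeRow N s (exchange T e f) f with hz'def
  have hz1 := hz'.1
  rw [del_exchange (not_isDiag_edge f) hf] at hz1
  -- The difference is a potential on all of `T` and orthogonal to `s`.
  have hsub : z' - (z' ᵥ* N) e • z = 0 := by
    refine eq_zero_of_isPotential_of_dotProduct hT.connected (hs.mono hle) hss
      (isPotential_of_del hN hle (e := e) ?_ ?_) ?_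
    · intro a b hab
      simp only [Pi.sub_apply, Pi.smul_apply, smul_eq_mul]
      rw [hz1 a b hab, hz.1 a b hab]
      ring
    · rw [Matrix.sub_vecMul, Matrix.smul_vecMul, Pi.sub_apply, Pi.smul_apply, hz.2]
      simp
    · rw [sub_dotProduct, smul_dotProduct, hzdef, hz'def, treeRow_dotProduct hss hT,
        treeRow_dotProduct hss hT', smul_zero, sub_zero]
  have h5 := hz'.2
  rw [sub_eq_zero.1 hsub, Matrix.smul_vecMul, Pi.smul_apply, smul_eq_mul] at h5
  linear_combination (z' ᵥ* N) e * hsq - (z ᵥ* N) f * h5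

/-- The path sign is `s i * s u` with `u` the end of `e` on the side of `i`. On the head side,
passing from `s u` to the value at the tail costs a factor `σ(e)`. -/
theorem treeRow_eq_treeTerm {s : V → ℝ}
    (hs : Γ.IsPotential Γ.graph s) (hss : ∀ v, s v * s v = 1) {T : SimpleGraph V}
    (hle : T ≤ Γ.graph) (hT : T.IsTree) {e : Γ.graph.edgeSet} (he : (e : Sym2 V) ∈ T.edgeSet)
    (i : V) : Γ.treeRow N s T e i =
      N (Γ.tail N e) e / Fintype.card V * Γ.treeTerm N T e i := by
  have hth := coe_eq_tail_head (N := N) e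
  have hcompl := headComp_eq_compl (N := N) hT he
  have hsth : s (Γ.head N e) = ((Γ.sign e : ℤ) : ℝ) * s (Γ.tail N e) := by
    have hadj : Γ.graph.Adj (Γ.tail N e) (Γ.head N e) := by
      have := e.2
      rwa [hth] at this
    rw [hs _ _ hadj, ← hth, realSign_coe]
  have hσ := units_cast_mul_self (Γ.sign e)
  have hex : ∃ u ∈ {u | u ∈ (e : Sym2 V)}, (del T e).Reachable u i := by
    by_cases hi : i ∈ Γ.tailComp N T e
    · exact ⟨_, tail_mem e, hi⟩
    · rw [← Set.mem_compl_iff, ← hcompl] at hi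
      exact ⟨_, head_mem e, hi⟩
  obtain ⟨u, hu, hui, hsu⟩ := (hs.mono ((del_le T e).trans hle)).exists_eq_pathSign_mul _ i hex
  have hu' : u = Γ.tail N e ∨ u = Γ.head N e := by
    have : u ∈ (e : Sym2 V) := hu
    rwa [hth, Sym2.mem_iff] at this
  change s i = Γ.edgePathSign T e i * s u at hsu
  have hP : Γ.edgePathSign T e i = s i * s u := by
    linear_combination -s u * hsu - Γ.edgePathSign T e i * hss u
  rw [treeRow_apply he, treeTerm, sideSize, hP]
  split_ifs with hi
  · have : u = Γ.tail N e := by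
      refine hu'.resolve_right fun h => ?_
      rw [h] at hui
      have : i ∈ Γ.headComp N T e := hui
      rw [hcompl] at this
      exact this hi
    rw [this]
    ring
  · have : u = Γ.head N e := by
      refine hu'.resolve_left fun h => ?_
      rw [h] at hui
      exact hi hui
    rw [this, hsth]
    linear_combination N (Γ.tail N e) e / Fintype.card V * s (Γ.tail N e) * s i *
      (Γ.tailComp N T e).ncard * hσ

/-- The orthogonal projection on the complement of the switching function `s`. -/
noncomputable def switchProj (s : V → ℝ) : Matrix V V ℝ :=
  1 - (Fintype.card V : ℝ)⁻¹ • Matrix.vecMulVec s s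

theorem vecMul_switchProj {s y : V → ℝ} (h : y ⬝ᵥ s = 0) : y ᵥ* switchProj s = y := by
  rw [switchProj, Matrix.vecMul_sub, Matrix.vecMul_one, Matrix.vecMul_smul, Matrix.vecMul_vecMulVec,
    h]
  simp

theorem switchProj_mul (hN : Γ.IsIncidenceMatrix N) {s : V → ℝ}
    (hs : Γ.IsPotential Γ.graph s) : switchProj s * N = N := by
  have h0 : s ᵥ* N = 0 := funext fun f => (hN.isPotential_iff le_rfl s).1 hs f f.2
  have h1 : Matrix.vecMulVec s (0 : Γ.graph.edgeSet → ℝ) = 0 := by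
    ext i e
    simp [Matrix.vecMulVec_apply]
  rw [switchProj, Matrix.sub_mul, Matrix.one_mul, Matrix.smul_mul, Matrix.vecMulVec_mul, h0, h1,
    smul_zero, sub_zero]

variable [Fintype Γ.graph.edgeSet]

/-- The rows of the difference of the two sides are orthogonal to the columns of `T` and to `s`,
hence zero. -/
theorem mul_treeRow (hN : Γ.IsIncidenceMatrix N) {s : V → ℝ}
    (hs : Γ.IsPotential Γ.graph s) (hss : ∀ v, s v * s v = 1) {T : SimpleGraph V}
    (hle : T ≤ Γ.graph) (hT : T.IsTree) : N * Matrix.of (Γ.treeRow N s T) = switchProj s := by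
  have hn : (Fintype.card V : ℝ) ≠ 0 := by
    have := hT.connected.nonempty
    exact Nat.cast_ne_zero.2 Fintype.card_ne_zero
  rw [← sub_eq_zero]
  set D := N * Matrix.of (Γ.treeRow N s T) - switchProj s with hD
  ext i j
  refine congrFun (eq_zero_of_isPotential_of_dotProduct hT.connected (hs.mono hle) hss
    (y := D i) ?_ ?_) j
  · rw [hN.isPotential_iff hle]
    intro f hf
    have h1 : (D * N) i f = 0 := by
      rw [hD, Matrix.sub_mul, switchProj_mul hN hs, Matrix.mul_assoc, Matrix.sub_apply,
        Matrix.mul_apply, Fintype.sum_eq_single f]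
      · have : (Matrix.of (Γ.treeRow N s T) * N) f f = 1 :=
          (isDualRow_treeRow hN hs hss hle hT hf).2
        rw [this, mul_one, sub_self]
      · intro e hef
        have : (Matrix.of (Γ.treeRow N s T) * N) e f = 0 := by
          change (Γ.treeRow N s T e ᵥ* N) f = 0
          by_cases he : (e : Sym2 V) ∈ T.edgeSet
          · exact vecMul_eq_zero_of_isPotential_del hN hle
              (isDualRow_treeRow hN hs hss hle hT he).1 hf hef.symm
          · rw [treeRow_of_notMem he, Matrix.zero_vecMul]
            rfl
        rw [this, mul_zero]
    exact h1
  · have h1 : D *ᵥ s = 0 := by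
      have h2 : Matrix.of (Γ.treeRow N s T) *ᵥ s = 0 :=
        funext fun e => treeRow_dotProduct hss hT e
      have h3 : s ⬝ᵥ s = Fintype.card V := by
        simp [dotProduct, hss]
      rw [hD, Matrix.sub_mulVec, ← Matrix.mulVec_mulVec, h2, Matrix.mulVec_zero, switchProj,
        Matrix.sub_mulVec, Matrix.one_mulVec, Matrix.smul_mulVec, Matrix.vecMulVec_mulVec, h3]
      ext v
      simp only [Pi.sub_apply, Pi.smul_apply, smul_eq_mul, Pi.zero_apply, MulOpposite.smul_eq_mul_unop,
        MulOpposite.unop_op]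
      field_simp
      ring
    exact congrFun h1 i

/-- The Moore–Penrose inverse of the incidence matrix of a balanced signed graph is an average over
the spanning trees. -/
theorem moorePenrose_balanced (hN : Γ.IsIncidenceMatrix N) (hconn : Γ.graph.Connected) {s : V → ℝ}
    (hs : Γ.IsPotential Γ.graph s) (hss : ∀ v, s v * s v = 1) :
    moorePenrose N = averagedInverse Γ.spanningTrees (fun _ => 1) (Γ.treeRow N s) := by
  apply IsMoorePenroseInverse.moorePenrose_eq
  refine isMoorePenroseInverse_averagedInverse (Q := switchProj s) _ _ _ ?_ ?_
    (switchProj_mul hN hs) ?_ ?_ ?_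
  · simpa using (spanningTrees_nonempty hconn).ne_empty
  · rw [switchProj, Matrix.transpose_sub, Matrix.transpose_one, Matrix.transpose_smul,
      Matrix.transpose_vecMulVec]
  · intro T hT e
    exact vecMul_switchProj (treeRow_dotProduct hss (mem_spanningTrees_iff.1 hT).2 e)
  · intro T hT
    obtain ⟨hle, hT⟩ := mem_spanningTrees_iff.1 hT
    exact mul_treeRow hN hs hss hle hT
  · apply sum_dual_symm
    · exact fun T _ e he => treeRow_of_notMem he
    · intro T hT e f he hf hfe
      obtain ⟨hle, hT⟩ := mem_spanningTrees_iff.1 hT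
      exact vecMul_eq_zero_of_isPotential_del hN hle
        (isDualRow_treeRow hN hs hss hle hT he).1 hf hfe
    · intro T hT e f he hf h0
      obtain ⟨hle, hT⟩ := mem_spanningTrees_iff.1 hT
      simp only [one_mul]
      exact treeRow_exchange hN hs hss hle hT he hf h0

theorem moorePenrose_balanced_apply (hN : Γ.IsIncidenceMatrix N) (hconn : Γ.graph.Connected)
    (hΓ : Γ.Balanced) (e : Γ.graph.edgeSet) (i : V) :
    moorePenrose N e i = N (Γ.tail N e) e / (Fintype.card V * Γ.numSpanningTrees) *
      ∑ T ∈ Γ.spanningTreesWith e, Γ.treeTerm N T e i := by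
  obtain ⟨s, hs, hss⟩ := hΓ.exists_switching hconn
  rw [moorePenrose_balanced hN hconn hs hss, averagedInverse, Matrix.of_apply, spanningTreesWith,
    Finset.sum_filter, Finset.sum_const, numSpanningTrees, Finset.mul_sum, Finset.mul_sum]
  refine Finset.sum_congr rfl fun T hT => ?_
  obtain ⟨hle, hT⟩ := mem_spanningTrees_iff.1 hT
  split_ifs with he
  · rw [treeRow_eq_treeTerm hs hss hle hT he, nsmul_eq_mul]
    field_simp
  · rw [treeRow_of_notMem he]
    simp

/-- The tail entry of `N` occurs once in each factor and squares to 1; the product of the two tree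
sums is the sum over pairs of trees. -/
theorem sum_moorePenrose_balanced (hN : Γ.IsIncidenceMatrix N) (hconn : Γ.graph.Connected)
    (hΓ : Γ.Balanced) (i j : V) :
    ((moorePenrose N)ᵀ * moorePenrose N) i j =
      1 / ((Fintype.card V : ℝ) ^ 2 * (Γ.numSpanningTrees : ℝ) ^ 2) *
        ∑ e : Γ.graph.edgeSet, ∑ T ∈ Γ.spanningTreesWith e, ∑ T' ∈ Γ.spanningTreesWith e,
          Γ.edgePathSign T e i * Γ.edgePathSign T' e j * Γ.sizeFactor N T T' e i j := by
  classical
  rw [Matrix.mul_apply, Finset.mul_sum]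
  refine Finset.sum_congr rfl fun e _ => ?_
  have hNt := hN.entry_mul_self (tail_mem (N := N) e)
  have hmem : ∀ T ∈ Γ.spanningTreesWith e, T.IsTree ∧ (e : Sym2 V) ∈ T.edgeSet := by
    intro T hT
    have hT := Finset.mem_filter.1 hT
    exact ⟨(mem_spanningTrees_iff.1 hT.1).2, hT.2⟩
  have hsum : ∑ T ∈ Γ.spanningTreesWith e, ∑ T' ∈ Γ.spanningTreesWith e,
      Γ.edgePathSign T e i * Γ.edgePathSign T' e j * Γ.sizeFactor N T T' e i j =
      (∑ T ∈ Γ.spanningTreesWith e, Γ.treeTerm N T e i) *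
        ∑ T ∈ Γ.spanningTreesWith e, Γ.treeTerm N T e j := by
    rw [Finset.sum_mul_sum]
    refine Finset.sum_congr rfl fun T hT => Finset.sum_congr rfl fun T' hT' => ?_
    exact (treeTerm_mul_treeTerm (hmem T hT).1 (hmem T' hT').1 (hmem T hT).2 (hmem T' hT').2 i j).symm
  rw [hsum, Matrix.transpose_apply, moorePenrose_balanced_apply hN hconn hΓ,
    moorePenrose_balanced_apply hN hconn hΓ]
  set S := ∑ T ∈ Γ.spanningTreesWith e, Γ.treeTerm N T e i
  set S' := ∑ T ∈ Γ.spanningTreesWith e, Γ.treeTerm N T e j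
  calc _ = (N (Γ.tail N e) e * N (Γ.tail N e) e) /
        ((Fintype.card V : ℝ) ^ 2 * (Γ.numSpanningTrees : ℝ) ^ 2) * (S * S') := by ring
    _ = _ := by rw [hNt]

end SignedGraph

/-! ### The theorem. -/

theorem theorem5p1 {V : Type*} [Fintype V] [LinearOrder V] (Γ : SignedGraph V)
    [DecidableRel Γ.graph.Adj] (hn : 2 ≤ Fintype.card V) (hconn : Γ.graph.Connected)
    (N : Matrix V Γ.graph.edgeSet ℝ) (hN : Γ.IsIncidenceMatrix N) :
    Γ.laplacian = N * N.transpose ∧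
    moorePenrose Γ.laplacian = (moorePenrose N).transpose * moorePenrose N ∧
    (Γ.Balanced → ∀ i j : V,
      moorePenrose Γ.laplacian i j =
        1 / ((Fintype.card V : ℝ) ^ 2 * (Γ.numSpanningTrees : ℝ) ^ 2) *
          ∑ e : Γ.graph.edgeSet, ∑ T ∈ Γ.spanningTreesWith e, ∑ T' ∈ Γ.spanningTreesWith e,
            Γ.edgePathSign T e i * Γ.edgePathSign T' e j * Γ.sizeFactor N T T' e i j) ∧
    (¬ Γ.Balanced →
      IsUnit Γ.laplacian ∧
      (∀ i j : V,
        (Γ.laplacian)⁻¹ i j =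
          1 / (∑ H ∈ Γ.spanningTUs, (4 : ℝ) ^ Γ.numUnicyclic H) ^ 2 *
            ∑ e : Γ.graph.edgeSet,
              (∑ H ∈ Γ.spanningTUsWith e,
                (4 : ℝ) ^ Γ.numUnicyclic H * moorePenrose (Γ.restrictCols N H) e i) *
              (∑ H ∈ Γ.spanningTUsWith e,
                (4 : ℝ) ^ Γ.numUnicyclic H * moorePenrose (Γ.restrictCols N H) e j)) ∧
      (∀ e : Γ.graph.edgeSet, ∀ H ∈ Γ.spanningTUsWith e, ∀ j : V,
        moorePenrose (Γ.restrictCols N H) e j = Γ.endWeight N e * Γ.tuEntry N H e j)) := by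
  have hL := hN.laplacian_eq
  have hLP : moorePenrose Γ.laplacian = (moorePenrose N).transpose * moorePenrose N := by
    rw [hL, moorePenrose_mul_transpose]
  refine ⟨hL, hLP, fun hΓ i j => ?_, fun hΓ => ?_⟩
  · rw [hLP, SignedGraph.sum_moorePenrose_balanced hN hconn hΓ]
  · have hker := SignedGraph.eq_zero_of_isPotential_of_not_balanced hconn hΓ
    have hunit : IsUnit Γ.laplacian := hL ▸ SignedGraph.isUnit_mul_transpose hN hker
    refine ⟨hunit, fun i j => ?_, fun e H hH j => ?_⟩
    · rw [← (SignedGraph.isMoorePenroseInverse_inv hunit).moorePenrose_eq, hLP, Matrix.mul_apply,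
        Finset.mul_sum]
      refine Finset.sum_congr rfl fun e _ => ?_
      rw [Matrix.transpose_apply, SignedGraph.moorePenrose_unbalanced_apply hN hker,
        SignedGraph.moorePenrose_unbalanced_apply hN hker]
      ring
    · classical
      have hH := Finset.mem_filter.1 hH
      have hns := (SignedGraph.mem_spanningTUs_iff hN).1 hH.1
      rw [hns.moorePenrose_restrictCols hN, Matrix.of_apply]
      exact hns.dualRow_eq_tuEntry hN hH.2 (hns.isDualRow_dualRow hN e hH.2) j
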